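/- Let $\mathbb K=\mathbb R$ or $\mathbb C$, let $n\ge 2$ and $2\le p\le\infty$. A Banach sequence space is a Banach space $F$ of sequences with $\ell_1\subseteq F\subseteq\ell_\infty$ (over $\mathbb K$) such that $|x(k)|\le|y(k)|$ for all $k$ and $y\in F$ imply $x\in F$ and $\|x\|_F\le\|y\|_F$. Its Köthe dual is $F^\times=\{z\in\mathbb K^{\mathbb N}:\sum_k|z(k)x(k)|<\infty\text{ for all }x\in F\}$, with norm $\|z\|_{F^\times}=\sup_{\|x\|_F\le1}\sum_k|z(k)x(k)|$; $F$ is Köthe reflexive if the canonical inclusion $F\subseteq F^{\times\times}$ is surjective. For $\alpha\in\mathbb K^{\mathbb N}$ let $T_\alpha$ be the diagonal $n$-linear operator $T_\alpha(x_1,\dots,x_n)=(\alpha(k)x_1(k)\cdots x_n(k))_k$. A continuous $n$-linear $T:\ell_p\times\cdots\times\ell_p\to F$ is extendible if for every Banach space $X\supseteq\ell_p$ it extends to a continuous $n$-linear map $X\times\cdots\times X\to F$, and $\|T\|_{\mathcal E}$ is the infimum of the $C>0$ such that for every $X\supseteq\ell_p$ there is such an extension of norm at most $C$. Let $K_G$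 be Grothendieck's constant of $\mathbb K$. Let $F$ be a Köthe reflexive Banach sequence space. Then, for every $\alpha\in\mathbb K^{\mathbb N}$, $T_\alpha$ is a well-defined continuous and extendible operator $\ell_p\times\cdots\times\ell_p\to F$ if and only if $\alpha\in F$. For every such $\alpha$, $$\|T_\alpha\|_{\mathcal E}\le\|\alpha\|_F\qquad\text{and}\qquad\|\alpha\|_{F^{\times\times}}\le K_G^{\,n-1}\,\|T_\alpha\|_{\mathcal E},$$ and the norms $\|\alpha\|_F$ and $\|T_\alpha\|_{\mathcal E}$ are equivalent: there is a constant $c$, independent of $\alpha$, with $\|\alpha\|_F\le c\,\|T_\alpha\|_{\mathcal E}$. If moreover $\|\cdot\|_F=\|\cdot\|_{F^{\times\times}}$ on $F$, then $\|\alpha\|_F\le K_G^{\,n-1}\,\|T_\alpha\|_{\mathcal E}$. -/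

import Mathlib

open scoped ENNReal

universe u v

/-- A Banach sequence space over `𝕜`: a linear subspace `carrier` of `𝕜^ℕ` with
`ℓ₁ ⊆ carrier ⊆ ℓ_∞`, complete under a norm `nrm`, and solid: `|x| ≤ |y|` coordinatewise with
`y` in the space forces `x` into the space with `‖x‖ ≤ ‖y‖`. Only the values of `nrm` on `carrier`
are constrained, and only these are ever used. -/
structure BanachSequenceSpace (𝕜 : Type u) [RCLike 𝕜] where
  carrier : Submodule 𝕜 (ℕ → 𝕜)
  nrm : (ℕ → 𝕜) → ℝ
  nrm_add_le : ∀ x ∈ carrier, ∀ y ∈ carrier, nrm (x + y) ≤ nrm x + nrm y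
  nrm_smul : ∀ c : 𝕜, ∀ x ∈ carrier, nrm (c • x) = ‖c‖ * nrm x
  eq_zero_of_nrm : ∀ x ∈ carrier, nrm x = 0 → x = 0
  complete : ∀ f : ℕ → ℕ → 𝕜, (∀ m, f m ∈ carrier) →
    (∀ ε > 0, ∃ N, ∀ m ≥ N, ∀ k ≥ N, nrm (f m - f k) < ε) →
    ∃ x ∈ carrier, ∀ ε > 0, ∃ N, ∀ m ≥ N, nrm (f m - x) < ε
  mem_of_memℓp_one : ∀ x : ℕ → 𝕜, Memℓp x 1 → x ∈ carrier
  memℓp_top_of_mem : ∀ x ∈ carrier, Memℓp x ∞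
  mem_of_le : ∀ x : ℕ → 𝕜, ∀ y ∈ carrier, (∀ k, ‖x k‖ ≤ ‖y k‖) → x ∈ carrier
  nrm_le_of_le : ∀ x : ℕ → 𝕜, ∀ y ∈ carrier, (∀ k, ‖x k‖ ≤ ‖y k‖) → nrm x ≤ nrm y

namespace BanachSequenceSpace

variable {𝕜 : Type u} [RCLike 𝕜]

/-- The elements of `F` as a type. It is a separate definition, so that it carries the
norm topology of `F` and not the product topology of `𝕜^ℕ`. -/
def Elem (F : BanachSequenceSpace 𝕜) : Type u := F.carrier

instance (F : BanachSequenceSpace 𝕜) : AddCommGroup F.Elem :=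
  inferInstanceAs (AddCommGroup F.carrier)

instance (F : BanachSequenceSpace 𝕜) : Module 𝕜 F.Elem :=
  inferInstanceAs (Module 𝕜 F.carrier)

/-- The sequence underlying an element of `F`. -/
def Elem.seq {F : BanachSequenceSpace 𝕜} (x : F.Elem) : ℕ → 𝕜 := Subtype.val x

theorem nrm_zero (F : BanachSequenceSpace 𝕜) : F.nrm 0 = 0 := by
  have h := F.nrm_smul 0 0 F.carrier.zero_mem
  simpa using h

theorem nrm_neg (F : BanachSequenceSpace 𝕜) {x : ℕ → 𝕜} (hx : x ∈ F.carrier) :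
    F.nrm (-x) = F.nrm x := by
  have h := F.nrm_smul (-1) x hx
  simpa using h

noncomputable instance (F : BanachSequenceSpace 𝕜) : NormedAddCommGroup F.Elem :=
  AddGroupNorm.toNormedAddCommGroup
    { toFun := fun x => F.nrm x.seq
      map_zero' := F.nrm_zero
      add_le' := fun x y => F.nrm_add_le x.1 x.2 y.1 y.2
      neg' := fun x => F.nrm_neg x.2
      eq_zero_of_map_eq_zero' := fun x hx => Subtype.ext (F.eq_zero_of_nrm x.1 x.2 hx) }

theorem norm_def {F : BanachSequenceSpace 𝕜} (x : F.Elem) : ‖x‖ = F.nrm x.seq := rfl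

noncomputable instance (F : BanachSequenceSpace 𝕜) : NormedSpace 𝕜 F.Elem where
  norm_smul_le := fun c x => (F.nrm_smul c x.1 x.2).le

instance (F : BanachSequenceSpace 𝕜) : CompleteSpace F.Elem := by
  refine Metric.complete_of_cauchySeq_tendsto fun f hf => ?_
  obtain ⟨x, hx, h⟩ := F.complete (fun m => (f m).seq) (fun m => (f m).2) (fun ε hε => by
    obtain ⟨N, hN⟩ := Metric.cauchySeq_iff.1 hf ε hε
    refine ⟨N, fun m hm k hk => ?_⟩
    have h := hN m hm k hk
    rw [dist_eq_norm] at h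
    exact h)
  let y : F.Elem := (⟨x, hx⟩ : F.carrier)
  refine ⟨y, Metric.tendsto_atTop.2 fun ε hε => ?_⟩
  obtain ⟨N, hN⟩ := h ε hε
  refine ⟨N, fun m hm => ?_⟩
  rw [dist_eq_norm]
  exact hN m hm

end BanachSequenceSpace

section Kothe

variable {𝕜 : Type u} [RCLike 𝕜]

/-- The Köthe dual of a set `S` of sequences:
all `z` such that `∑ |z j * x j| < ∞` for every `x ∈ S`. -/
def kotheDual (S : Set (ℕ → 𝕜)) : Set (ℕ → 𝕜) :=
  {z | ∀ x ∈ S, Summable fun j => ‖z j * x j‖}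

/-- The Köthe dual norm of `z`, for a set `S` of sequences with norm `N`:
the supremum of `∑ |z j * x j|` over all `x ∈ S` with `N x ≤ 1`, in `[0, ∞]`. -/
noncomputable def kotheNorm (S : Set (ℕ → 𝕜)) (N : (ℕ → 𝕜) → ℝ≥0∞) (z : ℕ → 𝕜) : ℝ≥0∞ :=
  ⨆ x ∈ S, ⨆ _ : N x ≤ 1, ∑' j, ‖z j * x j‖ₑ

namespace BanachSequenceSpace

/-- The Köthe bidual `F^{××}` of `F`. -/
def kotheBidual (F : BanachSequenceSpace 𝕜) : Set (ℕ → 𝕜) :=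
  kotheDual (kotheDual (F.carrier : Set (ℕ → 𝕜)))

/-- The norm of the Köthe bidual `F^{××}` of `F`. -/
noncomputable def kotheBidualNorm (F : BanachSequenceSpace 𝕜) : (ℕ → 𝕜) → ℝ≥0∞ :=
  kotheNorm (kotheDual (F.carrier : Set (ℕ → 𝕜)))
    (kotheNorm (F.carrier : Set (ℕ → 𝕜)) fun x => ENNReal.ofReal (F.nrm x))

/-- `F` is Köthe reflexive: the canonical inclusion of `F` into `F^{××}` is surjective. -/
def IsKotheReflexive (F : BanachSequenceSpace 𝕜) : Prop :=
  ∀ z ∈ F.kotheBidual, z ∈ F.carrier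

end BanachSequenceSpace

end Kothe

section Extendible

variable {𝕜 : Type*} [RCLike 𝕜] {E : Type u} [NormedAddCommGroup E] [NormedSpace 𝕜 E]
  {G : Type v} [NormedAddCommGroup G] [NormedSpace 𝕜 G] {n : ℕ}

/-- A continuous `n`-linear map `T : E × ⋯ × E → G` is extendible if for every Banach space `X`
containing `E` (through a linear isometry `ι`) some continuous `n`-linear `X × ⋯ × X → G`
extends `T`. Spaces `X` in the universe of `E` are enough: the injective space
`ℓ_∞(B_{E'})` is one of them. -/
def IsExtendible (T : ContinuousMultilinearMap 𝕜 (fun _ : Fin n => E) G) : Prop :=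
  ∀ (X : Type u) [NormedAddCommGroup X] [NormedSpace 𝕜 X] [CompleteSpace X] (ι : E →ₗᵢ[𝕜] X),
    ∃ S : ContinuousMultilinearMap 𝕜 (fun _ : Fin n => X) G,
      ∀ x : Fin n → E, S (fun i => ι (x i)) = T x

/-- The extendible norm: the infimum of the `C > 0` such that `T` has, on every Banach space
containing `E`, an extension of norm at most `C`. -/
noncomputable def extendibleNorm (T : ContinuousMultilinearMap 𝕜 (fun _ : Fin n => E) G) : ℝ :=
  sInf {C : ℝ | 0 < C ∧
    ∀ (X : Type u) [NormedAddCommGroup X] [NormedSpace 𝕜 X] [CompleteSpace X] (ι : E →ₗᵢ[𝕜] X),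
      ∃ S : ContinuousMultilinearMap 𝕜 (fun _ : Fin n => X) G,
        (∀ x : Fin n → E, S (fun i => ι (x i)) = T x) ∧ ‖S‖ ≤ C}

end Extendible

section Diagonal

variable {𝕜 : Type u} [RCLike 𝕜] {n : ℕ} {p : ℝ≥0∞} [Fact (1 ≤ p)] {F : BanachSequenceSpace 𝕜}

/-- `T` is the diagonal operator `T_α : ℓ_p × ⋯ × ℓ_p → F`, that is
`T(x₁, …, xₙ) = (α(k) x₁(k) ⋯ xₙ(k))_k`. -/
def IsDiagonalOperator (α : ℕ → 𝕜)
    (T : ContinuousMultilinearMap 𝕜 (fun _ : Fin n => lp (fun _ : ℕ => 𝕜) p) F.Elem) : Prop :=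
  ∀ (x : Fin n → lp (fun _ : ℕ => 𝕜) p) (k : ℕ), (T x).seq k = α k * ∏ i, x i k

/-- The set `ℓ_n(𝓔, p, F)` of the sequences `α` for which `T_α` is a well defined (continuous)
extendible operator `ℓ_p × ⋯ × ℓ_p → F`. -/
def extendibleDiagonals (n : ℕ) (p : ℝ≥0∞) [Fact (1 ≤ p)] (F : BanachSequenceSpace 𝕜) :
    Set (ℕ → 𝕜) :=
  {α | ∃ T : ContinuousMultilinearMap 𝕜 (fun _ : Fin n => lp (fun _ : ℕ => 𝕜) p) F.Elem,
    IsDiagonalOperator α T ∧ IsExtendible T}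

end Diagonal

/-- Grothendieck's constant `K_G` of the field `𝕜` (`ℝ` or `ℂ`): the least `K ≥ 0` such that
`|∑ a i j ⟪x i, y j⟫| ≤ K` for all vectors `x i`, `y j` in the unit ball of a Hilbert space over
`𝕜`, whenever `|∑ a i j (s i) (t j)| ≤ 1` for all scalars `s i`, `t j` of modulus at most `1`.
Finitely many vectors span a finite-dimensional space, so the spaces `𝕜^d` are enough. By
Grothendieck's inequality the infimum is taken over a non-empty set. -/
noncomputable def grothendieckConstant (𝕜 : Type*) [RCLike 𝕜] : ℝ :=
  sInf {K : ℝ | 0 ≤ K ∧ ∀ (l m : ℕ) (a : Matrix (Fin l) (Fin m) 𝕜),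
    (∀ (s : Fin l → 𝕜) (t : Fin m → 𝕜), (∀ i, ‖s i‖ ≤ 1) → (∀ j, ‖t j‖ ≤ 1) →
      ‖∑ i, ∑ j, a i j * s i * t j‖ ≤ 1) →
    ∀ (d : ℕ) (x : Fin l → EuclideanSpace 𝕜 (Fin d)) (y : Fin m → EuclideanSpace 𝕜 (Fin d)),
      (∀ i, ‖x i‖ ≤ 1) → (∀ j, ‖y j‖ ≤ 1) → ‖∑ i, ∑ j, a i j * inner 𝕜 (x i) (y j)‖ ≤ K}

/-! Upper bound. For `α ∈ F` and `X ⊇ ℓ_p`, Hahn-Banach extends every coordinate functional to some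
`g k` of norm at most one on `X`. Then `x ↦ (α k * ∏ g k (x i))_k` extends `T_α`, and solidity of
`F` bounds its norm by `‖α‖_F`, whatever `X` is (`IsDiagonalOperator.exists_extension`).

Lower bound. Embed `ℓ_p` in `ℓ_∞` of its dual ball. Since `p ≥ 2`, the norm of `ℓ_p` is at most that
of `ℓ_2`, so by duality `∑ |φ(e_k)|² ≤ 1` for each `φ` in the ball: the images of the unit vectors
are pointwise square summable. Composing an extension `S` of `T_α` with the pairing against an
element of `F^×` gives an `n`-linear form on `ℓ_∞`, and it suffices to bound its diagonal sum over
such a family by `K_G^(n-1)` times its norm (`norm_sum_multilinear_le`, `norm_sum_lpInfty_le`). For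
`n = 2` this is Grothendieck's inequality. In the induction one argument is first held fixed;
averaging over signs and one more use of Grothendieck's inequality let it vary with `k`
(`norm_sum_matrix_le`).

This places `α` in `F^{××}`, hence in `F` by reflexivity, with the stated bound on the bidual norm.
A gliding hump argument makes the two norms on `F` equivalent (`IsKotheReflexive.exists_nrm_le`).

As `K_G` is an infimum of reals, Grothendieck's inequality with some finite constant is needed too;
it is proved by truncating Rademacher sums (`HilbertBound.improve`). -/

section Rademacher

/-! ### Rademacher sums: orthogonality, fourth moments, Bessel's inequality -/

variable {𝕜 : Type u} [RCLike 𝕜]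

/-- The sum `∑ ± x k`, with signs given by `ω`. -/
def rademacherSum {d : ℕ} (x : Fin d → 𝕜) (ω : Fin d → Bool) : 𝕜 :=
  ∑ k, (if ω k then 1 else -1) * x k

theorem sum_bool_fin_succ {M : Type*} [AddCommMonoid M] {d : ℕ} (g : (Fin (d + 1) → Bool) → M) :
    ∑ ω, g ω = ∑ ω : Fin d → Bool,
      (g (Fin.cons true ω : Fin (d + 1) → Bool) + g (Fin.cons false ω : Fin (d + 1) → Bool)) := by
  rw [← (Fin.consEquiv fun _ : Fin (d + 1) => Bool).sum_comp, Fintype.sum_prod_type,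
    Fintype.sum_bool, ← Finset.sum_add_distrib]
  rfl

theorem rademacherSum_cons {d : ℕ} (x : Fin (d + 1) → 𝕜) (b : Bool) (ω : Fin d → Bool) :
    rademacherSum x (Fin.cons b ω : Fin (d + 1) → Bool) =
      (if b then 1 else -1) * x 0 + rademacherSum (fun k => x k.succ) ω := by
  simp [rademacherSum, Fin.sum_univ_succ]

/-- Orthogonality of the signs: on flipping the first sign the cross terms cancel. The pairing is
bilinear, without conjugation, as the later applications require. -/
theorem sum_rademacherSum_mul {d : ℕ} (x y : Fin d → 𝕜) :
    ∑ ω, rademacherSum x ω * rademacherSum y ω = 2 ^ d * ∑ k, x k * y k := by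
  induction d with
  | zero => simp [rademacherSum]
  | succ d ih =>
    rw [sum_bool_fin_succ, Fin.sum_univ_succ, mul_add, pow_succ, mul_comm ((2 : 𝕜) ^ d) 2,
      mul_assoc 2 _ (∑ k : Fin d, _), ← ih (fun k => x k.succ) (fun k => y k.succ),
      Finset.mul_sum]
    have h : ∀ ω : Fin d → Bool,
        rademacherSum x (Fin.cons true ω : Fin (d + 1) → Bool) *
            rademacherSum y (Fin.cons true ω : Fin (d + 1) → Bool) +
          rademacherSum x (Fin.cons false ω : Fin (d + 1) → Bool) *
            rademacherSum y (Fin.cons false ω : Fin (d + 1) → Bool) =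
        2 * (x 0 * y 0) +
          2 * (rademacherSum (fun k => x k.succ) ω * rademacherSum (fun k => y k.succ) ω) := by
      intro ω
      simp only [rademacherSum_cons]
      simp
      ring
    rw [Finset.sum_congr rfl fun ω _ => h ω, Finset.sum_add_distrib]
    simp
    ring

theorem star_rademacherSum {d : ℕ} (x : Fin d → 𝕜) (ω : Fin d → Bool) :
    star (rademacherSum x ω) = rademacherSum (fun k => star (x k)) ω := by
  simp only [rademacherSum, star_sum, star_mul']
  refine Finset.sum_congr rfl fun k _ => ?_
  split_ifs <;> simp

theorem mul_star_eq_ofReal_norm_sq (z : 𝕜) : z * star z = ((‖z‖ ^ 2 : ℝ) : 𝕜) := by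
  have := RCLike.mul_conj z
  push_cast
  exact this

theorem sum_norm_rademacherSum_sq {d : ℕ} (x : Fin d → 𝕜) :
    ∑ ω, ‖rademacherSum x ω‖ ^ 2 = 2 ^ d * ∑ k, ‖x k‖ ^ 2 := by
  have h := sum_rademacherSum_mul x (fun k => star (x k))
  simp only [← star_rademacherSum, mul_star_eq_ofReal_norm_sq] at h
  exact_mod_cast h

/-- The parallelogram law fixes the sum of the two squared norms, and both are at most `(‖x‖ +
‖y‖)²`; the sum of their squares is then largest when they are as far apart as possible, which is
the case of real scalars. -/
theorem norm_add_pow_four_add_norm_sub_pow_four_le (x y : 𝕜) :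
    ‖x + y‖ ^ 4 + ‖-x + y‖ ^ 4 ≤ 2 * (‖y‖ ^ 4 + 6 * ‖y‖ ^ 2 * ‖x‖ ^ 2 + ‖x‖ ^ 4) := by
  have h1 : ‖x + y‖ ^ 2 + ‖-x + y‖ ^ 2 = 2 * (‖x‖ ^ 2 + ‖y‖ ^ 2) := by
    have := parallelogram_law_with_norm 𝕜 x y
    rw [neg_add_eq_sub, norm_sub_rev y x]
    nlinarith [this]
  have h2 : ‖x + y‖ ≤ ‖x‖ + ‖y‖ := norm_add_le _ _
  have h3 : ‖-x + y‖ ≤ ‖x‖ + ‖y‖ := (norm_add_le _ _).trans_eq (by rw [norm_neg])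
  have h4 : ‖x + y‖ ^ 2 ≤ (‖x‖ + ‖y‖) ^ 2 := by gcongr
  have h5 : ‖-x + y‖ ^ 2 ≤ (‖x‖ + ‖y‖) ^ 2 := by gcongr
  nlinarith [mul_nonneg (sub_nonneg.2 h4) (sub_nonneg.2 h5)]

/-- Khinchin's inequality for the exponent 4. The induction closes because `3 s² + 6 s a² + a⁴ ≤ 3
(s + a²)²`. -/
theorem sum_norm_rademacherSum_pow_four_le {d : ℕ} (x : Fin d → 𝕜) :
    ∑ ω, ‖rademacherSum x ω‖ ^ 4 ≤ 2 ^ d * (3 * (∑ k, ‖x k‖ ^ 2) ^ 2) := by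
  induction d with
  | zero => simp [rademacherSum]
  | succ d ih =>
    have h : ∀ ω : Fin d → Bool,
        ‖rademacherSum x (Fin.cons true ω : Fin (d + 1) → Bool)‖ ^ 4 +
          ‖rademacherSum x (Fin.cons false ω : Fin (d + 1) → Bool)‖ ^ 4 ≤
        2 * (‖rademacherSum (fun k => x k.succ) ω‖ ^ 4 +
          6 * ‖rademacherSum (fun k => x k.succ) ω‖ ^ 2 * ‖x 0‖ ^ 2 + ‖x 0‖ ^ 4) := by
      intro ω
      simp only [rademacherSum_cons]
      simpa using norm_add_pow_four_add_norm_sub_pow_four_le (x 0)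
        (rademacherSum (fun k => x k.succ) ω)
    rw [sum_bool_fin_succ, Fin.sum_univ_succ]
    refine (Finset.sum_le_sum fun ω _ => h ω).trans ?_
    rw [← Finset.mul_sum, Finset.sum_add_distrib, Finset.sum_add_distrib, ← Finset.sum_mul,
      ← Finset.mul_sum, sum_norm_rademacherSum_sq]
    have := ih (fun k => x k.succ)
    simp only [Finset.sum_const, Finset.card_univ, Fintype.card_fun, Fintype.card_bool,
      Fintype.card_fin, nsmul_eq_mul]
    push_cast
    set s := ∑ k : Fin d, ‖x k.succ‖ ^ 2
    have hp : (0 : ℝ) ≤ 2 ^ d * ‖x 0‖ ^ 4 := by positivity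
    rw [pow_succ (2 : ℝ) d]
    nlinarith

/-- Bessel's inequality for the Rademacher functions. -/
theorem sum_norm_rademacher_coeff_sq_le {d : ℕ} (t : (Fin d → Bool) → 𝕜) (ht : ∀ ω, ‖t ω‖ ≤ 1) :
    ∑ k, ‖((2 : 𝕜) ^ d)⁻¹ * ∑ ω, (if ω k then 1 else -1) * t ω‖ ^ 2 ≤ 1 := by
  set c : Fin d → 𝕜 := fun k => ((2 : 𝕜) ^ d)⁻¹ * ∑ ω, (if ω k then 1 else -1) * t ω with hc
  set s : ℝ := ∑ k, ‖c k‖ ^ 2 with hs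
  have hs0 : 0 ≤ s := Finset.sum_nonneg fun k _ => by positivity
  -- Testing `t` against the Rademacher sum of its own conjugated coefficients gives `2^d * s`;
  -- Cauchy-Schwarz then yields `s² ≤ s`.
  have h1 : (2 : 𝕜) ^ d * (s : 𝕜) = ∑ ω, rademacherSum (fun k => star (c k)) ω * t ω := by
    have h2 : ∀ k, (2 : 𝕜) ^ d * c k = ∑ ω, (if ω k then 1 else -1) * t ω := fun k => by
      simp [hc]
    calc (2 : 𝕜) ^ d * (s : 𝕜) = ∑ k, star (c k) * ((2 : 𝕜) ^ d * c k) := by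
          rw [hs, RCLike.ofReal_sum, Finset.mul_sum]
          refine Finset.sum_congr rfl fun k _ => ?_
          rw [← mul_star_eq_ofReal_norm_sq]
          ring
      _ = _ := by
          simp only [h2, rademacherSum, Finset.mul_sum, Finset.sum_mul]
          rw [Finset.sum_comm]
          refine Finset.sum_congr rfl fun ω _ => Finset.sum_congr rfl fun k _ => ?_
          ring
  have h3 : 2 ^ d * s ≤ ∑ ω, ‖rademacherSum (fun k => star (c k)) ω‖ * 1 := by
    have h := congrArg norm h1
    rw [norm_mul, norm_pow, RCLike.norm_two, RCLike.norm_ofReal, abs_of_nonneg hs0] at h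
    rw [h]
    refine (norm_sum_le _ _).trans (Finset.sum_le_sum fun ω _ => ?_)
    rw [norm_mul]
    gcongr
    exact ht ω
  have h4 := Finset.sum_mul_sq_le_sq_mul_sq Finset.univ
    (fun ω => ‖rademacherSum (fun k => star (c k)) ω‖) (fun _ : Fin d → Bool => (1 : ℝ))
  rw [sum_norm_rademacherSum_sq] at h4
  simp only [norm_star, ← hs, one_pow, Finset.sum_const, Finset.card_univ, Fintype.card_fun,
    Fintype.card_bool, Fintype.card_fin, nsmul_eq_mul, mul_one] at h4 h3
  push_cast at h4
  have h5 : (2 ^ d * s) ^ 2 ≤ 2 ^ d * s * 2 ^ d := (by gcongr : _ ≤ _).trans h4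
  have hp : (0 : ℝ) < 2 ^ d := by positivity
  by_contra hlt
  push Not at hlt
  have : 2 ^ d * s * 2 ^ d < (2 ^ d * s) ^ 2 := by
    have : (2 ^ d * s) ^ 2 - 2 ^ d * s * 2 ^ d = (2 ^ d) ^ 2 * (s * (s - 1)) := by ring
    have : 0 < (2 ^ d : ℝ) ^ 2 * (s * (s - 1)) :=
      mul_pos (by positivity) (mul_pos (by linarith) (by linarith))
    linarith
  linarith

end Rademacher

/-! ### Grothendieck's inequality -/

section Grothendieck

variable {𝕜 : Type u} [RCLike 𝕜]

/-- `K` bounds the form with matrix `a`, evaluated at vectors of unit balls of spaces `ℓ₂(κ)`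
with `κ` finite. -/
def HilbertBound {I J : Type*} [Fintype I] [Fintype J] (a : I → J → 𝕜) (K : ℝ) : Prop :=
  ∀ (κ : Type) [Fintype κ] (x : I → κ → 𝕜) (y : J → κ → 𝕜),
    (∀ i, ∑ k, ‖x i k‖ ^ 2 ≤ 1) → (∀ j, ∑ k, ‖y j k‖ ^ 2 ≤ 1) →
      ‖∑ i, ∑ j, a i j * ∑ k, x i k * y j k‖ ≤ K

theorem norm_sum_mul_le_sqrt_mul_sqrt {κ : Type*} [Fintype κ] (x y : κ → 𝕜) :
    ‖∑ k, x k * y k‖ ≤ √(∑ k, ‖x k‖ ^ 2) * √(∑ k, ‖y k‖ ^ 2) := by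
  refine (norm_sum_le _ _).trans ?_
  simp only [norm_mul]
  exact Real.sum_mul_le_sqrt_mul_sqrt _ _ _

/-- A crude finite bound depending on the matrix, needed only to start the iteration of
`HilbertBound.improve`. -/
theorem HilbertBound.sum_norm {I J : Type*} [Fintype I] [Fintype J] (a : I → J → 𝕜) :
    HilbertBound a (∑ i, ∑ j, ‖a i j‖) := by
  intro κ _ x y hx hy
  refine (norm_sum_le _ _).trans (Finset.sum_le_sum fun i _ => (norm_sum_le _ _).trans
    (Finset.sum_le_sum fun j _ => ?_))
  rw [norm_mul]
  refine mul_le_of_le_one_right (norm_nonneg _) ((norm_sum_mul_le_sqrt_mul_sqrt _ _).trans ?_)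
  exact mul_le_one₀ (Real.sqrt_le_one.2 (hx i)) (Real.sqrt_nonneg _) (Real.sqrt_le_one.2 (hy j))

theorem HilbertBound.scaled {I J : Type*} [Fintype I] [Fintype J] {a : I → J → 𝕜} {K : ℝ}
    (h : HilbertBound a K) {κ : Type} [Fintype κ] (x : I → κ → 𝕜) (y : J → κ → 𝕜) {r s : ℝ}
    (hr : 0 < r) (hs : 0 < s) (hx : ∀ i, ∑ k, ‖x i k‖ ^ 2 ≤ r ^ 2)
    (hy : ∀ j, ∑ k, ‖y j k‖ ^ 2 ≤ s ^ 2) :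
    ‖∑ i, ∑ j, a i j * ∑ k, x i k * y j k‖ ≤ r * s * K := by
  have h1 := h κ (fun i k => ((r⁻¹ : ℝ) : 𝕜) * x i k) (fun j k => ((s⁻¹ : ℝ) : 𝕜) * y j k)
    (fun i => by
      simp only [norm_mul, mul_pow, ← Finset.mul_sum, RCLike.norm_ofReal, sq_abs]
      rw [inv_pow, inv_mul_le_iff₀ (by positivity), mul_one]
      exact hx i)
    (fun j => by
      simp only [norm_mul, mul_pow, ← Finset.mul_sum, RCLike.norm_ofReal, sq_abs]
      rw [inv_pow, inv_mul_le_iff₀ (by positivity), mul_one]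
      exact hy j)
  have h2 : ∑ i, ∑ j, a i j * ∑ k, ((r⁻¹ : ℝ) : 𝕜) * x i k * (((s⁻¹ : ℝ) : 𝕜) * y j k) =
      (((r * s)⁻¹ : ℝ) : 𝕜) * ∑ i, ∑ j, a i j * ∑ k, x i k * y j k := by
    simp only [Finset.mul_sum]
    refine Finset.sum_congr rfl fun i _ => Finset.sum_congr rfl fun j _ =>
      Finset.sum_congr rfl fun k _ => ?_
    push_cast
    rw [mul_inv]
    ring
  rw [h2, norm_mul, RCLike.norm_ofReal, abs_of_pos (by positivity),
    inv_mul_le_iff₀ (by positivity)] at h1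
  exact h1

/-- The part of `z` that remains after truncation at height `t`. -/
noncomputable def truncate (t : ℝ) (z : 𝕜) : 𝕜 := if ‖z‖ ≤ t then z else 0

theorem norm_truncate_le {t : ℝ} (ht : 0 ≤ t) (z : 𝕜) : ‖truncate t z‖ ≤ t := by
  unfold truncate
  split_ifs with h
  · exact h
  · simpa using ht

theorem norm_truncate_le_norm (t : ℝ) (z : 𝕜) : ‖truncate t z‖ ≤ ‖z‖ := by
  unfold truncate
  split_ifs <;> simp

/-- Where the truncation removes `z`, the factor `‖z‖² / t²` is at least one. Thus a bound on fourth
moments makes the tail small in `ℓ_2`. -/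
theorem norm_sub_truncate_sq_le {t : ℝ} (ht : 0 < t) (z : 𝕜) :
    ‖z - truncate t z‖ ^ 2 ≤ ‖z‖ ^ 4 / t ^ 2 := by
  unfold truncate
  split_ifs with h
  · rw [sub_self, norm_zero, zero_pow two_ne_zero]
    positivity
  · rw [sub_zero, le_div_iff₀ (by positivity)]
    have : t ^ 2 ≤ ‖z‖ ^ 2 := by
      push Not at h
      gcongr
    nlinarith [sq_nonneg ‖z‖]

/-- Represent the vectors by Rademacher sums `f i`, `g j` and truncate these. The truncated parts
are bounded scalars for each choice of signs, so the hypothesis on `a` applies; the tails are small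
vectors in `ℓ_2` over the signs, so the old bound `K` applies with a small factor. -/
theorem HilbertBound.improve {I J : Type*} [Fintype I] [Fintype J] {a : I → J → 𝕜}
    (ha : ∀ (s : I → 𝕜) (t : J → 𝕜), (∀ i, ‖s i‖ ≤ 1) → (∀ j, ‖t j‖ ≤ 1) →
      ‖∑ i, ∑ j, a i j * s i * t j‖ ≤ 1) {K : ℝ} (h : HilbertBound a K) :
    HilbertBound a (48 + K / 2) := by
  intro κ _ x₀ y₀ hx₀ hy₀
  set d := Fintype.card κ
  set e := Fintype.equivFin κ
  set x : I → Fin d → 𝕜 := fun i k => x₀ i (e.symm k) with hxd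
  set y : J → Fin d → 𝕜 := fun j k => y₀ j (e.symm k) with hyd
  have hx : ∀ i, ∑ k, ‖x i k‖ ^ 2 ≤ 1 := fun i =>
    (e.symm.sum_comp fun k => ‖x₀ i k‖ ^ 2).trans_le (hx₀ i)
  have hy : ∀ j, ∑ k, ‖y j k‖ ^ 2 ≤ 1 := fun j =>
    (e.symm.sum_comp fun k => ‖y₀ j k‖ ^ 2).trans_le (hy₀ j)
  have hxy : ∀ i j, ∑ k, x₀ i k * y₀ j k = ∑ k, x i k * y j k := fun i j =>
    (e.symm.sum_comp fun k => x₀ i k * y₀ j k).symm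
  simp only [hxy]
  clear_value x y
  -- With fourth moments at most 3, the mean square of a tail is at most `3 / 48 = (1/4)²`. Two
  -- terms contain a tail, so together they contribute `K / 2`.
  set t : ℝ := √48
  have ht2 : t ^ 2 = 48 := Real.sq_sqrt (by norm_num)
  have ht : 0 < t := Real.sqrt_pos.2 (by norm_num)
  set r : ℝ := √(2 ^ d)
  have hr2 : r ^ 2 = 2 ^ d := Real.sq_sqrt (by positivity)
  have hr : 0 < r := Real.sqrt_pos.2 (by positivity)
  have hl2 : ∀ z : Fin d → 𝕜, ∑ k, ‖z k‖ ^ 2 ≤ 1 →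
      ∑ ω, ‖rademacherSum z ω‖ ^ 2 ≤ r ^ 2 := fun z hz => by
    rw [sum_norm_rademacherSum_sq, hr2]
    exact mul_le_of_le_one_right (by positivity) hz
  have htr : ∀ z : Fin d → 𝕜, ∑ k, ‖z k‖ ^ 2 ≤ 1 →
      ∑ ω, ‖truncate t (rademacherSum z ω)‖ ^ 2 ≤ r ^ 2 := fun z hz =>
    (Finset.sum_le_sum fun ω _ => by gcongr; exact norm_truncate_le_norm _ _).trans (hl2 z hz)
  have htl : ∀ z : Fin d → 𝕜, ∑ k, ‖z k‖ ^ 2 ≤ 1 →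
      ∑ ω, ‖rademacherSum z ω - truncate t (rademacherSum z ω)‖ ^ 2 ≤ (r / 4) ^ 2 := fun z hz => by
    refine (Finset.sum_le_sum fun ω _ => norm_sub_truncate_sq_le ht _).trans ?_
    rw [← Finset.sum_div, ht2, div_pow, hr2]
    have h1 := sum_norm_rademacherSum_pow_four_le z
    have h2 : (∑ k, ‖z k‖ ^ 2) ^ 2 ≤ 1 :=
      pow_le_one₀ (Finset.sum_nonneg fun k _ => by positivity) hz
    have h3 : (0 : ℝ) < 2 ^ d := by positivity
    nlinarith
  set f : I → (Fin d → Bool) → 𝕜 := fun i => rademacherSum (x i) with hf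
  set g : J → (Fin d → Bool) → 𝕜 := fun j => rademacherSum (y j) with hg
  -- With `f'`, `g'` the truncations: `f g = f' g' + (f - f') g' + f (g - g')`, so that each of the
  -- last two products has just one tail.
  have e1 : (2 : 𝕜) ^ d * ∑ i, ∑ j, a i j * ∑ k, x i k * y j k =
      ∑ ω, ∑ i, ∑ j, a i j * truncate t (f i ω) * truncate t (g j ω) +
      (∑ i, ∑ j, a i j * ∑ ω, (f i ω - truncate t (f i ω)) * truncate t (g j ω)) +
      ∑ i, ∑ j, a i j * ∑ ω, f i ω * (g j ω - truncate t (g j ω)) := by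
    have : ∀ i j, (2 : 𝕜) ^ d * (a i j * ∑ k, x i k * y j k) =
        a i j * ∑ ω, f i ω * g j ω := fun i j => by
      rw [sum_rademacherSum_mul]
      ring
    simp only [Finset.mul_sum (s := (Finset.univ : Finset I)),
      Finset.mul_sum (s := (Finset.univ : Finset J)), this]
    rw [Finset.sum_comm (s := (Finset.univ : Finset (Fin d → Bool)))]
    simp only [Finset.sum_comm (s := (Finset.univ : Finset (Fin d → Bool))) (t := Finset.univ (α := J)),
      Finset.mul_sum, ← Finset.sum_add_distrib]
    refine Finset.sum_congr rfl fun i _ => Finset.sum_congr rfl fun j _ =>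
      Finset.sum_congr rfl fun k _ => ?_
    ring
  have b1 : ‖∑ ω, ∑ i, ∑ j, a i j * truncate t (f i ω) * truncate t (g j ω)‖ ≤ 2 ^ d * 48 := by
    have : ∀ ω : Fin d → Bool,
        ‖∑ i, ∑ j, a i j * truncate t (f i ω) * truncate t (g j ω)‖ ≤ 48 := fun ω => by
      have h1 := ha (fun i => ((t⁻¹ : ℝ) : 𝕜) * truncate t (f i ω))
        (fun j => ((t⁻¹ : ℝ) : 𝕜) * truncate t (g j ω))
        (fun i => by
          rw [norm_mul, RCLike.norm_ofReal, abs_of_pos (by positivity),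
            inv_mul_le_iff₀ ht, mul_one]
          exact norm_truncate_le ht.le _)
        (fun i => by
          rw [norm_mul, RCLike.norm_ofReal, abs_of_pos (by positivity),
            inv_mul_le_iff₀ ht, mul_one]
          exact norm_truncate_le ht.le _)
      have h2 : ∑ i, ∑ j, a i j * (((t⁻¹ : ℝ) : 𝕜) * truncate t (f i ω)) *
            (((t⁻¹ : ℝ) : 𝕜) * truncate t (g j ω)) =
          (((t ^ 2)⁻¹ : ℝ) : 𝕜) *
            ∑ i, ∑ j, a i j * truncate t (f i ω) * truncate t (g j ω) := by
        simp only [Finset.mul_sum]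
        refine Finset.sum_congr rfl fun i _ => Finset.sum_congr rfl fun j _ => ?_
        push_cast
        ring
      rw [h2, norm_mul, RCLike.norm_ofReal, abs_of_pos (by positivity),
        inv_mul_le_iff₀ (by positivity), ht2, mul_one] at h1
      exact h1
    refine (norm_sum_le _ _).trans ((Finset.sum_le_sum fun ω _ => this ω).trans ?_)
    simp
  have b2 := h.scaled (fun i ω => f i ω - truncate t (f i ω)) (fun j ω => truncate t (g j ω))
    (r := r / 4) (s := r) (by positivity) hr (fun i => htl _ (hx i)) (fun j => htr _ (hy j))
  have b3 := h.scaled f (fun j ω => g j ω - truncate t (g j ω))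
    (r := r) (s := r / 4) hr (by positivity) (fun i => hl2 _ (hx i)) (fun j => htl _ (hy j))
  have e2 := congrArg norm e1
  rw [norm_mul, norm_pow, RCLike.norm_two] at e2
  have b4 := e2.trans_le ((norm_add_le _ _).trans
    (add_le_add ((norm_add_le _ _).trans (add_le_add b1 b2)) b3))
  have h3 : (0 : ℝ) < 2 ^ d := by positivity
  refine le_of_mul_le_mul_left (b4.trans_eq ?_) h3
  rw [← hr2]
  ring

/-- Grothendieck's inequality, with the constant `96`. -/
theorem hilbertBound_of_le_one {I J : Type*} [Fintype I] [Fintype J] {a : I → J → 𝕜}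
    (ha : ∀ (s : I → 𝕜) (t : J → 𝕜), (∀ i, ‖s i‖ ≤ 1) → (∀ j, ‖t j‖ ≤ 1) →
      ‖∑ i, ∑ j, a i j * s i * t j‖ ≤ 1) : HilbertBound a 96 := by
  set K₀ : ℝ := ∑ i, ∑ j, ‖a i j‖
  -- 96 is the fixed point of `K ↦ 48 + K / 2`, and each step halves the distance to it.
  have h : ∀ m : ℕ, HilbertBound a (96 + K₀ * (1 / 2) ^ m) := by
    intro m
    induction m with
    | zero =>
      intro κ _ x y hx hy
      refine (HilbertBound.sum_norm a κ x y hx hy).trans ?_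
      simp only [pow_zero, mul_one]
      linarith
    | succ m ih =>
      have := ih.improve ha
      convert this using 1
      ring
  intro κ _ x y hx hy
  have hlim : Filter.Tendsto (fun m : ℕ => 96 + K₀ * (1 / 2 : ℝ) ^ m) Filter.atTop
      (nhds (96 + K₀ * 0)) :=
    ((tendsto_pow_atTop_nhds_zero_of_lt_one (by norm_num) (by norm_num)).const_mul _).const_add _
  rw [mul_zero, add_zero] at hlim
  exact ge_of_tendsto' hlim fun m => h m κ x y hx hy

theorem star_sum_mul_eq_inner {d : ℕ} (x y : EuclideanSpace 𝕜 (Fin d)) :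
    inner 𝕜 x y = ∑ k, star (x k) * y k := by
  rw [PiLp.inner_apply]
  refine Finset.sum_congr rfl fun k _ => ?_
  rw [RCLike.inner_apply, mul_comm]
  rfl

/-- The real infimum of the empty set is 0, so no estimate with `grothendieckConstant` is available
before some admissible constant is known. -/
theorem grothendieckConstant_set_nonempty : {K : ℝ | 0 ≤ K ∧ ∀ (l m : ℕ)
    (a : Matrix (Fin l) (Fin m) 𝕜),
    (∀ (s : Fin l → 𝕜) (t : Fin m → 𝕜), (∀ i, ‖s i‖ ≤ 1) → (∀ j, ‖t j‖ ≤ 1) →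
      ‖∑ i, ∑ j, a i j * s i * t j‖ ≤ 1) →
    ∀ (d : ℕ) (x : Fin l → EuclideanSpace 𝕜 (Fin d)) (y : Fin m → EuclideanSpace 𝕜 (Fin d)),
      (∀ i, ‖x i‖ ≤ 1) → (∀ j, ‖y j‖ ≤ 1) →
        ‖∑ i, ∑ j, a i j * inner 𝕜 (x i) (y j)‖ ≤ K}.Nonempty := by
  refine ⟨96, by norm_num, fun l m a ha d x y hx hy => ?_⟩
  simp only [star_sum_mul_eq_inner]
  refine hilbertBound_of_le_one ha (Fin d) (fun i k => star (x i k)) (fun j k => y j k)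
    (fun i => ?_) (fun j => ?_)
  · simp only [norm_star, ← EuclideanSpace.norm_sq_eq]
    exact pow_le_one₀ (norm_nonneg _) (hx i)
  · simp only [← EuclideanSpace.norm_sq_eq]
    exact pow_le_one₀ (norm_nonneg _) (hy j)

theorem grothendieckConstant_nonneg : 0 ≤ grothendieckConstant 𝕜 :=
  Real.sInf_nonneg fun _ h => h.1

/-- Grothendieck's inequality in coordinates, with Grothendieck's constant. -/
theorem norm_sum_le_grothendieckConstant_mul_of_pos {I J κ : Type*} [Fintype I] [Fintype J]
    [Fintype κ] (a : I → J → 𝕜) {C : ℝ} (hC : 0 < C)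
    (ha : ∀ (s : I → 𝕜) (t : J → 𝕜), (∀ i, ‖s i‖ ≤ 1) → (∀ j, ‖t j‖ ≤ 1) →
      ‖∑ i, ∑ j, a i j * s i * t j‖ ≤ C)
    (x : I → κ → 𝕜) (y : J → κ → 𝕜)
    (hx : ∀ i, ∑ k, ‖x i k‖ ^ 2 ≤ 1) (hy : ∀ j, ∑ k, ‖y j k‖ ^ 2 ≤ 1) :
    ‖∑ i, ∑ j, a i j * ∑ k, x i k * y j k‖ ≤ grothendieckConstant 𝕜 * C := by
  rw [← div_le_iff₀ hC]
  refine le_csInf grothendieckConstant_set_nonempty fun K hK => ?_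
  set eI := (Fintype.equivFin I).symm
  set eJ := (Fintype.equivFin J).symm
  set eκ := (Fintype.equivFin κ).symm
  have hscale : ∀ b : I → J → 𝕜, ∑ i, ∑ j, ((C⁻¹ : ℝ) : 𝕜) * a i j * b i j =
      ((C⁻¹ : ℝ) : 𝕜) * ∑ i, ∑ j, a i j * b i j := fun b => by
    simp only [Finset.mul_sum, mul_assoc]
  have h := hK.2 _ _ (fun i j => ((C⁻¹ : ℝ) : 𝕜) * a (eI i) (eJ j))
    (fun s t hs ht => by
      have h1 := ha (fun i => s (eI.symm i)) (fun j => t (eJ.symm j)) (fun i => hs _)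
        (fun j => ht _)
      have h2 := hscale fun i j => s (eI.symm i) * t (eJ.symm j)
      rw [← eI.sum_comp] at h2
      simp only [← eJ.sum_comp (M := 𝕜), Equiv.symm_apply_apply, ← mul_assoc] at h2
      rw [h2, norm_mul, RCLike.norm_ofReal, abs_of_pos (by positivity), inv_mul_le_iff₀ hC, mul_one]
      rw [← eI.sum_comp] at h1
      simp only [← eJ.sum_comp (M := 𝕜), Equiv.symm_apply_apply] at h1
      refine le_of_eq_of_le (congrArg norm ?_) h1
      rw [← eI.sum_comp]
      simp only [Equiv.symm_apply_apply]) _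
    -- The conjugate turns the inner product, conjugate linear in its first argument, into the
    -- bilinear pairing.
    (fun i => WithLp.toLp 2 fun k => star (x (eI i) (eκ k)))
    (fun j => WithLp.toLp 2 fun k => y (eJ j) (eκ k))
    (fun i => by
      rw [← sq_le_one_iff₀ (norm_nonneg _), EuclideanSpace.norm_sq_eq]
      simp only [norm_star]
      exact (eκ.sum_comp fun k => ‖x (eI i) k‖ ^ 2).trans_le (hx _))
    (fun j => by
      rw [← sq_le_one_iff₀ (norm_nonneg _), EuclideanSpace.norm_sq_eq]
      exact (eκ.sum_comp fun k => ‖y (eJ j) k‖ ^ 2).trans_le (hy _))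
  simp only [star_sum_mul_eq_inner, star_star] at h
  have h2 := hscale fun i j => ∑ k, x i k * y j k
  rw [← eI.sum_comp] at h2
  simp only [← eJ.sum_comp (M := 𝕜), ← eκ.sum_comp (M := 𝕜)] at h2
  rw [h2, norm_mul, RCLike.norm_ofReal, abs_of_pos (by positivity), inv_mul_le_iff₀ hC] at h
  rw [div_le_iff₀' hC]
  simp only [← eJ.sum_comp (M := 𝕜), ← eκ.sum_comp (M := 𝕜)]
  exact h

/-- For `C = 0` one cannot divide by `C`; the positive case is applied to `C + ε` and `ε` tends to
0. -/
theorem norm_sum_le_grothendieckConstant_mul {I J κ : Type*} [Fintype I] [Fintype J] [Fintype κ]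
    (a : I → J → 𝕜) {C : ℝ} (hC : 0 ≤ C)
    (ha : ∀ (s : I → 𝕜) (t : J → 𝕜), (∀ i, ‖s i‖ ≤ 1) → (∀ j, ‖t j‖ ≤ 1) →
      ‖∑ i, ∑ j, a i j * s i * t j‖ ≤ C)
    (x : I → κ → 𝕜) (y : J → κ → 𝕜)
    (hx : ∀ i, ∑ k, ‖x i k‖ ^ 2 ≤ 1) (hy : ∀ j, ∑ k, ‖y j k‖ ^ 2 ≤ 1) :
    ‖∑ i, ∑ j, a i j * ∑ k, x i k * y j k‖ ≤ grothendieckConstant 𝕜 * C := by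
  have hlim : Filter.Tendsto (fun ε : ℝ => grothendieckConstant 𝕜 * (C + ε))
      (nhdsWithin 0 (Set.Ioi 0)) (nhds (grothendieckConstant 𝕜 * C)) := by
    refine (Continuous.tendsto' ?_ 0 _ (by simp)).mono_left nhdsWithin_le_nhds
    fun_prop
  refine ge_of_tendsto hlim ?_
  filter_upwards [self_mem_nhdsWithin] with ε hε
  have hε : 0 < ε := hε
  exact norm_sum_le_grothendieckConstant_mul_of_pos a (by positivity)
    (fun s t hs ht => (ha s t hs ht).trans (by linarith)) x y hx hy

end Grothendieck

/-! ### Diagonal sums of multilinear forms on finite-dimensional `ℓ_∞` -/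

section DiagonalSums

variable {𝕜 : Type u} [RCLike 𝕜]

/-- If matrices `R k` satisfy a bound on `∑ k, R k (s, z k)` for scalars `s` and square summable
families `z`, then averaging over signs and Grothendieck's inequality allow `s` to vary with `k`
in a square summable way. -/
theorem norm_sum_matrix_le {J L : Type*} [Fintype J] [Fintype L] {d : ℕ}
    (R : Fin d → J → L → 𝕜) {C : ℝ} (hC : 0 ≤ C)
    (hR : ∀ (s : J → 𝕜) (z : L → Fin d → 𝕜), (∀ j, ‖s j‖ ≤ 1) → (∀ l, ∑ k, ‖z l k‖ ^ 2 ≤ 1) →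
      ‖∑ k, ∑ j, ∑ l, R k j l * s j * z l k‖ ≤ C)
    (x : J → Fin d → 𝕜) (z : L → Fin d → 𝕜)
    (hx : ∀ j, ∑ k, ‖x j k‖ ^ 2 ≤ 1) (hz : ∀ l, ∑ k, ‖z l k‖ ^ 2 ≤ 1) :
    ‖∑ k, ∑ j, ∑ l, R k j l * x j k * z l k‖ ≤ grothendieckConstant 𝕜 * C := by
  -- The signs become part of the column index. Scalars `t (l, ω)` enter through their Rademacher
  -- coefficients, square summable by Bessel's inequality, so `hR` bounds this matrix by `C`. The
  -- Hilbert space vectors are `x j` and the signed families `z l`.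
  have h := norm_sum_le_grothendieckConstant_mul (I := J) (J := L × (Fin d → Bool))
    (fun j q => ((2 : 𝕜) ^ d)⁻¹ * rademacherSum (fun k => R k j q.1) q.2) hC
    (fun s t hs ht => by
      refine le_of_eq_of_le (congrArg norm ?_) (hR s
        (fun l k => ((2 : 𝕜) ^ d)⁻¹ * ∑ ω, (if ω k then 1 else -1) * t (l, ω)) hs
        fun l => sum_norm_rademacher_coeff_sq_le _ fun ω => ht (l, ω))
      simp only [Fintype.sum_prod_type, rademacherSum, Finset.mul_sum, Finset.sum_mul]
      rw [Finset.sum_comm (s := (Finset.univ : Finset (Fin d)))]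
      refine Finset.sum_congr rfl fun j _ => ?_
      rw [Finset.sum_comm (s := (Finset.univ : Finset (Fin d)))]
      refine Finset.sum_congr rfl fun l _ => ?_
      rw [Finset.sum_comm]
      refine Finset.sum_congr rfl fun k _ => Finset.sum_congr rfl fun ω _ => ?_
      ring)
    x (fun q k => (if q.2 k then 1 else -1) * z q.1 k) hx
    (fun q => by
      refine le_of_eq_of_le (Finset.sum_congr rfl fun k _ => ?_) (hz q.1)
      split_ifs <;> simp)
  refine le_of_eq_of_le (congrArg norm ?_) h
  -- Orthogonality of the signs recovers the diagonal sum over `k` from the average.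
  have h2 : ∀ j l, ∑ k, R k j l * x j k * z l k = ∑ ω : Fin d → Bool,
      ((2 : 𝕜) ^ d)⁻¹ * rademacherSum (fun k => R k j l) ω *
        ∑ k, x j k * ((if ω k then 1 else -1) * z l k) := fun j l => by
    have h3 := sum_rademacherSum_mul (fun k => R k j l) (fun k => x j k * z l k)
    have h4 : ∀ ω : Fin d → Bool, ∑ k, x j k * ((if ω k then 1 else -1) * z l k) =
        rademacherSum (fun k => x j k * z l k) ω := fun ω =>
      Finset.sum_congr rfl fun k _ => by ring
    simp only [h4, mul_assoc, ← Finset.mul_sum, h3]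
    rw [inv_mul_cancel_left₀ (pow_ne_zero _ two_ne_zero)]
  simp only [Fintype.sum_prod_type, ← h2]
  rw [Finset.sum_comm]
  refine Finset.sum_congr rfl fun j _ => ?_
  rw [Finset.sum_comm]

theorem bilinear_eq_sum {J L : Type*} [Fintype J] [Fintype L] [DecidableEq J] [DecidableEq L]
    (B : (J → 𝕜) →ₗ[𝕜] (L → 𝕜) →ₗ[𝕜] 𝕜) (s : J → 𝕜) (z : L → 𝕜) :
    B s z = ∑ j, ∑ l, B (Pi.single j 1) (Pi.single l 1) * s j * z l := by
  conv_lhs => rw [← Finset.univ_sum_single s, ← Finset.univ_sum_single z]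
  rw [map_sum, Finset.sum_comm]
  refine Finset.sum_congr rfl fun l _ => ?_
  rw [map_sum, LinearMap.sum_apply]
  refine Finset.sum_congr rfl fun j _ => ?_
  have hj : Pi.single j (s j) = s j • (Pi.single j 1 : J → 𝕜) := by
    rw [← Pi.single_smul, smul_eq_mul, mul_one]
  have hl : Pi.single l (z l) = z l • (Pi.single l 1 : L → 𝕜) := by
    rw [← Pi.single_smul, smul_eq_mul, mul_one]
  rw [hj, hl, map_smul, map_smul, LinearMap.smul_apply, smul_eq_mul, smul_eq_mul]
  ring

theorem norm_sum_bilinear_le {J L : Type*} [Fintype J] [Fintype L] {d : ℕ}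
    (B : Fin d → (J → 𝕜) →ₗ[𝕜] (L → 𝕜) →ₗ[𝕜] 𝕜) {C : ℝ} (hC : 0 ≤ C)
    (hB : ∀ (s : J → 𝕜) (z : L → Fin d → 𝕜), (∀ j, ‖s j‖ ≤ 1) → (∀ l, ∑ k, ‖z l k‖ ^ 2 ≤ 1) →
      ‖∑ k, B k s (fun l => z l k)‖ ≤ C)
    (x : J → Fin d → 𝕜) (z : L → Fin d → 𝕜)
    (hx : ∀ j, ∑ k, ‖x j k‖ ^ 2 ≤ 1) (hz : ∀ l, ∑ k, ‖z l k‖ ^ 2 ≤ 1) :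
    ‖∑ k, B k (fun j => x j k) (fun l => z l k)‖ ≤ grothendieckConstant 𝕜 * C := by
  classical
  refine le_of_eq_of_le (congrArg norm (Finset.sum_congr rfl fun k _ => bilinear_eq_sum (B k) _ _))
    (norm_sum_matrix_le (fun k j l => B k (Pi.single j 1) (Pi.single l 1)) hC
      (fun s z hs hz => ?_) x z hx hz)
  exact le_of_eq_of_le (congrArg norm (Finset.sum_congr rfl fun k _ =>
    (bilinear_eq_sum (B k) _ _).symm)) (hB s z hs hz)

/-- The bilinear form obtained from a multilinear form by freezing all arguments except the first
two. -/
def MultilinearMap.firstTwo {m : ℕ} {V : Type*} [AddCommGroup V] [Module 𝕜 V]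
    (S : MultilinearMap 𝕜 (fun _ : Fin (m + 2) => V) 𝕜) (v : Fin (m + 1) → V) :
    V →ₗ[𝕜] V →ₗ[𝕜] 𝕜 :=
  LinearMap.mk₂ 𝕜 (fun y w => S.curryLeft y (Function.update v 0 w))
    (fun y y' w => by rw [map_add]; rfl) (fun c y w => by rw [map_smul]; rfl)
    (fun y w w' => MultilinearMap.map_update_add _ _ _ _ _)
    (fun c y w => MultilinearMap.map_update_smul _ _ _ _ _)

theorem MultilinearMap.firstTwo_apply {m : ℕ} {V : Type*} [AddCommGroup V] [Module 𝕜 V]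
    (S : MultilinearMap 𝕜 (fun _ : Fin (m + 2) => V) 𝕜) (v : Fin (m + 1) → V) (y w : V) :
    S.firstTwo v y w = S.curryLeft y (Function.update v 0 w) := rfl

theorem MultilinearMap.firstTwo_self {m : ℕ} {V : Type*} [AddCommGroup V] [Module 𝕜 V]
    (S : MultilinearMap 𝕜 (fun _ : Fin (m + 2) => V) 𝕜) (v : Fin (m + 2) → V) :
    S.firstTwo (Fin.tail v) (v 0) (v 1) = S v := by
  rw [MultilinearMap.firstTwo_apply, MultilinearMap.curryLeft_apply]
  congr 1
  have : v 1 = Fin.tail v 0 := rfl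
  rw [this, Function.update_eq_self, Fin.cons_self_tail]

/-- A multilinear form on `ℓ_∞(J)` summed along the diagonal of square summable families. -/
theorem norm_sum_multilinear_le {J : Type*} [Fintype J] {d : ℕ} {C : ℝ} (hC : 0 ≤ C) (m : ℕ)
    (S : MultilinearMap 𝕜 (fun _ : Fin (m + 2) => J → 𝕜) 𝕜)
    (hS : ∀ v : Fin (m + 2) → J → 𝕜, (∀ i j, ‖v i j‖ ≤ 1) → ‖S v‖ ≤ C)
    (x : Fin (m + 2) → J → Fin d → 𝕜) (hx : ∀ i j, ∑ k, ‖x i j k‖ ^ 2 ≤ 1) :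
    ‖∑ k, S (fun i j => x i j k)‖ ≤ grothendieckConstant 𝕜 ^ (m + 1) * C := by
  classical
  induction m with
  | zero =>
    have hB : ∀ v : Fin 2 → J → 𝕜, S v = S.firstTwo 0 (v 0) (v 1) := fun v => by
      rw [MultilinearMap.firstTwo_apply, MultilinearMap.curryLeft_apply]
      congr 1
      funext i
      refine Fin.cases rfl (fun i => ?_) i
      rw [Subsingleton.elim i 0]
      simp
    have h := norm_sum_le_grothendieckConstant_mul
      (fun j l => S.firstTwo 0 (Pi.single j 1) (Pi.single l 1)) hC
      (fun s t hs ht => by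
        rw [← bilinear_eq_sum]
        have := hB ![s, t]
        simp only [Matrix.cons_val_zero, Matrix.cons_val_one] at this
        rw [← this]
        refine hS _ fun i j => ?_
        fin_cases i
        · exact hs j
        · exact ht j)
      (x 0) (x 1) (hx 0) (hx 1)
    rw [← pow_one (grothendieckConstant 𝕜)] at h
    refine le_of_eq_of_le (congrArg norm ((Finset.sum_congr rfl fun k _ =>
      (hB _).trans (bilinear_eq_sum _ _ _)).trans ?_)) h
    simp only [Finset.mul_sum]
    rw [Finset.sum_comm]
    refine Finset.sum_congr rfl fun j _ => ?_
    rw [Finset.sum_comm]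
    simp only [mul_assoc]
  | succ m ih =>
    -- The arguments after the second, which depend on `k`, are absorbed into the `k`-th bilinear
    -- form. With the first argument frozen at `s`, the induction hypothesis for `S.curryLeft s` is
    -- the bound required of these forms.
    have h := norm_sum_bilinear_le
      (fun k => S.firstTwo (Fin.tail fun i j => x i j k))
      (C := grothendieckConstant 𝕜 ^ (m + 1) * C)
      (mul_nonneg (pow_nonneg grothendieckConstant_nonneg _) hC)
      (fun s z hs hz => by
        have h1 := ih (S.curryLeft s)
          (fun v hv => hS _ fun i j => by
            refine Fin.cases ?_ (fun i => ?_) i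
            · exact hs j
            · exact hv i j)
          (Function.update (fun i => x i.succ) 0 z)
          (fun i j => by
            rcases eq_or_ne i 0 with rfl | hi
            · rw [Function.update_self]
              exact hz j
            · rw [Function.update_of_ne hi]
              exact hx _ j)
        refine le_of_eq_of_le (congrArg norm (Finset.sum_congr rfl fun k _ => ?_)) h1
        rw [MultilinearMap.firstTwo_apply]
        congr 1
        funext i
        rcases eq_or_ne i 0 with rfl | hi
        · simp only [Function.update_self]
        · simp only [Function.update_of_ne hi]
          rfl)
      (x 0) (x 1) (hx 0) (hx 1)
    rw [pow_succ', mul_assoc]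
    refine le_of_eq_of_le (congrArg norm (Finset.sum_congr rfl fun k _ => ?_)) h
    exact (MultilinearMap.firstTwo_self S fun i j => x i j k).symm

end DiagonalSums

/-! ### From an extension on `ℓ_∞(I)` to estimates for `α` -/

section CoreBound

variable {𝕜 : Type u} [RCLike 𝕜]

/-- All entries are at most 1 in modulus, so `|c|^p ≤ |c|²` for finite `p`. This is where `2 ≤ p`
enters. -/
theorem lp.norm_sum_single_le_one {p : ℝ≥0∞} [Fact (1 ≤ p)] (hp : 2 ≤ p) {N : ℕ}
    (c : Fin N → 𝕜) (hc : ∑ k, ‖c k‖ ^ 2 ≤ 1) :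
    ‖∑ k : Fin N, lp.single (E := fun _ : ℕ => 𝕜) p (k : ℕ) (c k)‖ ≤ 1 := by
  classical
  set b : ℕ → 𝕜 := fun j => if h : j < N then c ⟨j, h⟩ else 0 with hb
  have hbc : ∀ k : Fin N, b k = c k := fun k => by simp [hb]
  have hsum : ∑ k : Fin N, lp.single (E := fun _ : ℕ => 𝕜) p (k : ℕ) (c k) =
      ∑ k ∈ Finset.range N, lp.single (E := fun _ : ℕ => 𝕜) p k (b k) := by
    rw [Finset.sum_range]
    simp only [hbc]
  have hb2 : ∑ k ∈ Finset.range N, ‖b k‖ ^ 2 ≤ 1 := by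
    rw [Finset.sum_range]
    simpa only [hbc] using hc
  have hle : ∀ k ∈ Finset.range N, ‖b k‖ ≤ 1 := fun k hk => by
    rw [← sq_le_one_iff₀ (norm_nonneg _)]
    exact (Finset.single_le_sum (f := fun k => ‖b k‖ ^ 2) (fun _ _ => by positivity) hk).trans hb2
  rw [hsum]
  rcases eq_or_ne p ∞ with rfl | hp'
  · refine lp.norm_le_of_forall_le zero_le_one fun j => ?_
    rw [lp.coeFn_sum, Finset.sum_apply]
    simp only [lp.single_apply, Pi.single_apply]
    rw [Finset.sum_ite_eq]
    split_ifs with h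
    · exact hle j h
    · simp
  · have h2 : (2 : ℝ) ≤ p.toReal := by
      have := ENNReal.toReal_mono hp' hp
      simpa using this
    have h0 : 0 < p.toReal := by linarith
    rw [← Real.rpow_le_rpow_iff (norm_nonneg _) zero_le_one h0, Real.one_rpow,
      lp.norm_sum_single h0]
    refine (Finset.sum_le_sum fun k hk => ?_).trans hb2
    rw [← Real.rpow_natCast]
    exact Real.rpow_le_rpow_of_exponent_ge' (norm_nonneg _) (hle k hk) (by norm_num)
      (by exact_mod_cast h2)

/-- Dual to the contraction `ℓ_2 → ℓ_p`: `φ` is tested on the normalized conjugate of its own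
coefficients, where its value is the `ℓ_2` norm of these. -/
theorem sum_norm_apply_single_sq_le_one {p : ℝ≥0∞} [Fact (1 ≤ p)] (hp : 2 ≤ p)
    (φ : StrongDual 𝕜 (lp (fun _ : ℕ => 𝕜) p)) (hφ : ‖φ‖ ≤ 1) (N : ℕ) :
    ∑ k : Fin N, ‖φ (lp.single (E := fun _ : ℕ => 𝕜) p (k : ℕ) 1)‖ ^ 2 ≤ 1 := by
  set a : Fin N → 𝕜 := fun k => φ (lp.single (E := fun _ : ℕ => 𝕜) p (k : ℕ) 1) with ha
  set s : ℝ := ∑ k, ‖a k‖ ^ 2 with hs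
  have hs0 : 0 ≤ s := Finset.sum_nonneg fun k _ => by positivity
  rcases hs0.eq_or_lt with h0 | h0
  · rw [← h0]
    exact zero_le_one
  have hr : 0 < √s := Real.sqrt_pos.2 h0
  have hr2 : √s ^ 2 = s := Real.sq_sqrt hs0
  have h1 := lp.norm_sum_single_le_one hp (fun k => (((√s)⁻¹ : ℝ) : 𝕜) * star (a k)) (by
    simp only [norm_mul, mul_pow, norm_star, ← Finset.mul_sum, RCLike.norm_ofReal, sq_abs, inv_pow,
      hr2, ← hs]
    rw [inv_mul_cancel₀ h0.ne'])
  have h2 : φ (∑ k : Fin N, lp.single (E := fun _ : ℕ => 𝕜) p (k : ℕ)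
      ((((√s)⁻¹ : ℝ) : 𝕜) * star (a k))) = ((√s : ℝ) : 𝕜) := by
    have h3 : ∀ k : Fin N, φ (lp.single (E := fun _ : ℕ => 𝕜) p (k : ℕ)
        ((((√s)⁻¹ : ℝ) : 𝕜) * star (a k))) = (((√s)⁻¹ : ℝ) : 𝕜) * ((‖a k‖ ^ 2 : ℝ) : 𝕜) := by
      intro k
      have := lp.single_smul (E := fun _ : ℕ => 𝕜) p (k : ℕ)
        ((((√s)⁻¹ : ℝ) : 𝕜) * star (a k)) (1 : 𝕜)
      rw [smul_eq_mul, mul_one] at this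
      rw [this, map_smul, smul_eq_mul, ← mul_star_eq_ofReal_norm_sq, mul_assoc, mul_comm (star _)]
    rw [map_sum]
    simp only [h3]
    rw [← Finset.mul_sum, ← RCLike.ofReal_sum, ← hs, ← RCLike.ofReal_mul]
    congr 1
    rw [inv_mul_eq_iff_eq_mul₀ hr.ne', ← sq, hr2]
  have h4 := φ.le_of_opNorm_le_of_le hφ h1
  rw [h2, RCLike.norm_ofReal, abs_of_pos hr, mul_one] at h4
  rw [← hr2]
  exact pow_le_one₀ hr.le h4

/-- The canonical isometric embedding of `E` into `ℓ_∞` on the unit ball of its dual. -/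
noncomputable def dualBallEmbedding (𝕜 : Type u) [RCLike 𝕜] (E : Type u) [NormedAddCommGroup E]
    [NormedSpace 𝕜 E] : E →ₗᵢ[𝕜] lp (fun _ : {φ : StrongDual 𝕜 E // ‖φ‖ ≤ 1} => 𝕜) ∞ where
  toFun x := ⟨fun φ => φ.1 x, memℓp_infty ⟨‖x‖, by
    rintro _ ⟨φ, rfl⟩
    exact (φ.1.le_of_opNorm_le φ.2 x).trans_eq (one_mul _)⟩⟩
  map_add' x y := by
    ext φ
    exact map_add φ.1 x y
  map_smul' c x := by
    ext φ
    exact map_smul φ.1 c x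
  norm_map' x := by
    refine le_antisymm (lp.norm_le_of_forall_le (norm_nonneg _) fun φ =>
      (φ.1.le_of_opNorm_le φ.2 x).trans_eq (one_mul _)) ?_
    obtain ⟨g, hg, hgx⟩ := exists_dual_vector'' 𝕜 x
    refine le_of_eq_of_le ?_ (lp.norm_apply_le_norm ENNReal.top_ne_zero _ ⟨g, hg⟩)
    change ‖x‖ = ‖g x‖
    rw [hgx, RCLike.norm_ofReal, abs_of_nonneg (norm_nonneg _)]

/-- Composition of bounded functions with a map `r`, from a finite set. -/
def lpInftyComp (𝕜 : Type u) [RCLike 𝕜] {I J : Type*} [Finite J] (r : I → J) :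
    (J → 𝕜) →ₗ[𝕜] lp (fun _ : I => 𝕜) ∞ where
  toFun v := ⟨fun i => v (r i), memℓp_infty ((Set.finite_range fun j => ‖v j‖).bddAbove.mono (by
    rintro _ ⟨i, rfl⟩
    exact ⟨r i, rfl⟩))⟩
  map_add' _ _ := rfl
  map_smul' _ _ := rfl

/-- Reduction to a finite index set: `i ↦ (a k i)_k` takes values in the compact unit ball of `𝕜^d`.
Rounding them to a finite `δ`-net inside the ball keeps the square sums at most 1 and makes the
family factor through the net. -/
theorem exists_approx_norm_sum_le {I : Type*} {m d : ℕ}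
    (a : Fin d → lp (fun _ : I => 𝕜) ∞) (ha : ∀ i, ∑ k, ‖a k i‖ ^ 2 ≤ 1)
    (S : ContinuousMultilinearMap 𝕜 (fun _ : Fin (m + 2) => lp (fun _ : I => 𝕜) ∞) 𝕜)
    (θ : Fin d → 𝕜) (hθ : ∀ k, ‖θ k‖ ≤ 1) {δ : ℝ} (hδ : 0 < δ) :
    ∃ b : Fin d → lp (fun _ : I => 𝕜) ∞, (∀ k, ‖b k - a k‖ ≤ δ) ∧
      ‖∑ k, θ k * S (fun _ => b k)‖ ≤ grothendieckConstant 𝕜 ^ (m + 1) * ‖S‖ := by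
  classical
  set A : I → EuclideanSpace 𝕜 (Fin d) := fun i => WithLp.toLp 2 fun k => a k i with hA
  have hA1 : ∀ i, A i ∈ Metric.closedBall (0 : EuclideanSpace 𝕜 (Fin d)) 1 := fun i => by
    rw [mem_closedBall_zero_iff, ← sq_le_one_iff₀ (norm_nonneg _), EuclideanSpace.norm_sq_eq]
    exact ha i
  obtain ⟨t, ht, htf, htc⟩ :=
    (isCompact_closedBall (0 : EuclideanSpace 𝕜 (Fin d)) 1).finite_cover_balls hδ
  have hr : ∀ i, ∃ w : t, dist (A i) w < δ := fun i => by
    obtain ⟨w, hw, h⟩ := Set.mem_iUnion₂.1 (htc (hA1 i))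
    exact ⟨⟨w, hw⟩, h⟩
  choose r hr using hr
  have : Fintype t := htf.fintype
  have ht1 : ∀ w : t, ∑ k, ‖w.1 k‖ ^ 2 ≤ 1 := fun w => by
    rw [← EuclideanSpace.norm_sq_eq]
    exact pow_le_one₀ (norm_nonneg _) (mem_closedBall_zero_iff.1 (ht w.2))
  refine ⟨fun k => lpInftyComp 𝕜 r fun w : t => w.1 k, fun k => ?_, ?_⟩
  · refine lp.norm_le_of_forall_le hδ.le fun i => ?_
    have h1 : ‖(A i - (r i).1) k‖ ≤ ‖A i - (r i).1‖ := PiLp.norm_apply_le _ k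
    rw [← dist_eq_norm, PiLp.sub_apply, norm_sub_rev] at h1
    exact h1.trans (hr i).le
  · have h := norm_sum_multilinear_le (norm_nonneg S) m
      (S.toMultilinearMap.compLinearMap fun _ => lpInftyComp 𝕜 r)
      (fun v hv => by
        refine S.unit_le_opNorm ((pi_norm_le_iff_of_nonneg zero_le_one).2 fun i => ?_)
        exact lp.norm_le_of_forall_le zero_le_one fun j => hv i (r j))
      -- The weights `θ k` are absorbed into the first argument.
      (fun i (w : t) k => (if i = 0 then θ k else 1) * w.1 k)
      (fun i w => by
        refine (Finset.sum_le_sum fun k _ => ?_).trans (ht1 w)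
        rw [norm_mul, mul_pow]
        refine mul_le_of_le_one_left (by positivity) (pow_le_one₀ (norm_nonneg _) ?_)
        split_ifs
        · exact hθ k
        · simp)
    refine le_of_eq_of_le (congrArg norm (Finset.sum_congr rfl fun k _ => ?_)) h
    have h2 := (S.toMultilinearMap.compLinearMap fun _ => lpInftyComp 𝕜 r).map_smul_univ
      (fun i => if i = 0 then θ k else 1) (fun _ (w : t) => w.1 k)
    rw [Finset.prod_ite_eq', if_pos (Finset.mem_univ _)] at h2
    exact h2.symm

theorem norm_sum_lpInfty_le {I : Type*} {m d : ℕ}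
    (a : Fin d → lp (fun _ : I => 𝕜) ∞) (ha : ∀ i, ∑ k, ‖a k i‖ ^ 2 ≤ 1)
    (S : ContinuousMultilinearMap 𝕜 (fun _ : Fin (m + 2) => lp (fun _ : I => 𝕜) ∞) 𝕜)
    (θ : Fin d → 𝕜) (hθ : ∀ k, ‖θ k‖ ≤ 1) :
    ‖∑ k, θ k * S (fun _ => a k)‖ ≤ grothendieckConstant 𝕜 ^ (m + 1) * ‖S‖ := by
  choose b hb hbS using fun N : ℕ =>
    exists_approx_norm_sum_le a ha S θ hθ (δ := 1 / ((N : ℝ) + 1)) (by positivity)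
  have hlim : ∀ k, Filter.Tendsto (fun N => b N k) Filter.atTop (nhds (a k)) := fun k => by
    rw [tendsto_iff_norm_sub_tendsto_zero]
    exact squeeze_zero (fun _ => norm_nonneg _) (fun N => hb N k)
      tendsto_one_div_add_atTop_nhds_zero_nat
  have h : Filter.Tendsto (fun N => ‖∑ k, θ k * S (fun _ => b N k)‖) Filter.atTop
      (nhds ‖∑ k, θ k * S (fun _ => a k)‖) := by
    refine (tendsto_finsetSum _ fun k _ => Filter.Tendsto.const_mul _ ?_).norm
    exact (S.cont.tendsto _).comp (tendsto_pi_nhds.2 fun _ => hlim k)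
  exact le_of_tendsto' h hbS

/-- The functional `x ↦ ∑ k < N, z k * x k` on a Banach sequence space. -/
def BanachSequenceSpace.partialPairing (F : BanachSequenceSpace 𝕜) (z : ℕ → 𝕜) (N : ℕ) :
    F.Elem →ₗ[𝕜] 𝕜 where
  toFun x := ∑ k : Fin N, z k * x.seq k
  map_add' x y := by
    rw [← Finset.sum_add_distrib]
    exact Finset.sum_congr rfl fun k _ => mul_add _ _ _
  map_smul' c x := by
    rw [RingHom.id_apply, smul_eq_mul, Finset.mul_sum]
    exact Finset.sum_congr rfl fun k _ => mul_left_comm _ _ _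

theorem BanachSequenceSpace.partialPairing_apply (F : BanachSequenceSpace 𝕜) (z : ℕ → 𝕜) (N : ℕ)
    (x : F.Elem) : F.partialPairing z N x = ∑ k : Fin N, z k * x.seq k := rfl

theorem partialPairing_diagonal_single {m : ℕ} {p : ℝ≥0∞} [Fact (1 ≤ p)]
    {F : BanachSequenceSpace 𝕜} {α : ℕ → 𝕜}
    {T : ContinuousMultilinearMap 𝕜 (fun _ : Fin (m + 1) => lp (fun _ : ℕ => 𝕜) p) F.Elem}
    (hT : IsDiagonalOperator α T) (z : ℕ → 𝕜) {N : ℕ} (k : Fin N) :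
    F.partialPairing z N (T fun _ => lp.single (E := fun _ : ℕ => 𝕜) p (k : ℕ) 1) =
      z k * α k := by
  rw [BanachSequenceSpace.partialPairing_apply, Finset.sum_eq_single k]
  · rw [hT]
    simp
  · intro j _ hj
    rw [hT]
    have : (j : ℕ) ≠ k := fun h => hj (Fin.ext h)
    simp [lp.single_apply, this]
  · simp

/-- If the diagonal operator `T_α` extends to some `ℓ_∞(I)`, with the unit vectors of
`ℓ_p` pointwise square summable on `I`, then `α` satisfies the
estimates that bound its norm in the Köthe bidual. -/
theorem sum_norm_mul_le_of_extension {m : ℕ} {p : ℝ≥0∞} [Fact (1 ≤ p)]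
    {F : BanachSequenceSpace 𝕜} {α : ℕ → 𝕜}
    {T : ContinuousMultilinearMap 𝕜 (fun _ : Fin (m + 2) => lp (fun _ : ℕ => 𝕜) p) F.Elem}
    (hT : IsDiagonalOperator α T)
    {I : Type*} (ι : lp (fun _ : ℕ => 𝕜) p → lp (fun _ : I => 𝕜) ∞)
    (hι : ∀ (N : ℕ) (i : I),
      ∑ k : Fin N, ‖ι (lp.single (E := fun _ : ℕ => 𝕜) p (k : ℕ) 1) i‖ ^ 2 ≤ 1)
    (S : ContinuousMultilinearMap 𝕜 (fun _ : Fin (m + 2) => lp (fun _ : I => 𝕜) ∞) F.Elem)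
    (hS : ∀ x, S (fun i => ι (x i)) = T x)
    (z : ℕ → 𝕜) {D : ℝ} (hD : 0 ≤ D) (N : ℕ)
    (hz : ∀ x ∈ F.carrier, ∑ k : Fin N, ‖z k * x k‖ ≤ D * F.nrm x) :
    ∑ k : Fin N, ‖z k * α k‖ ≤ grothendieckConstant 𝕜 ^ (m + 1) * (D * ‖S‖) := by
  have hψ₀ : ∀ x, ‖F.partialPairing z N x‖ ≤ D * ‖x‖ := fun x =>
    (norm_sum_le _ _).trans (hz x.seq x.2)
  obtain ⟨ψ, hψ, hψz⟩ : ∃ ψ : F.Elem →L[𝕜] 𝕜, ‖ψ‖ ≤ D ∧ ∀ x, ψ x = F.partialPairing z N x :=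
    ⟨(F.partialPairing z N).mkContinuous D hψ₀,
      (F.partialPairing z N).mkContinuous_norm_le hD hψ₀, fun _ => rfl⟩
  -- Unimodular `θ k` turn the terms `z k * α k` into their absolute values.
  choose θ hθ1 hθ using fun k : Fin N => RCLike.exists_norm_eq_mul_self (z k * α k)
  have h := norm_sum_lpInfty_le (d := N)
    (fun k => ι (lp.single (E := fun _ : ℕ => 𝕜) p (k : ℕ) 1))
    (hι N)
    (ψ.compContinuousMultilinearMap S) θ (fun k => (hθ1 k).le)
  have h1 : ∀ k : Fin N, θ k * ψ.compContinuousMultilinearMap S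
      (fun _ => ι (lp.single (E := fun _ : ℕ => 𝕜) p (k : ℕ) 1)) =
      ((‖z k * α k‖ : ℝ) : 𝕜) := fun k => by
    rw [ContinuousLinearMap.compContinuousMultilinearMap_coe, Function.comp_apply,
      hS fun _ => lp.single (E := fun _ : ℕ => 𝕜) p (k : ℕ) 1, hψz,
      partialPairing_diagonal_single hT, hθ]
  rw [Finset.sum_congr rfl fun k _ => h1 k, ← RCLike.ofReal_sum, RCLike.norm_ofReal,
    abs_of_nonneg (Finset.sum_nonneg fun _ _ => norm_nonneg _)] at h
  refine h.trans (mul_le_mul_of_nonneg_left ?_ (pow_nonneg grothendieckConstant_nonneg _))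
  exact (ψ.norm_compContinuousMultilinearMap_le S).trans (by gcongr)

end CoreBound

/-! ### Köthe duality and equivalence of norms -/

section SequenceSpaces

variable {𝕜 : Type u} [RCLike 𝕜]

namespace BanachSequenceSpace

variable (F : BanachSequenceSpace 𝕜)

theorem nrm_nonneg {x : ℕ → 𝕜} (hx : x ∈ F.carrier) : 0 ≤ F.nrm x :=
  norm_nonneg (show F.Elem from (⟨x, hx⟩ : F.carrier))

theorem single_mem (k : ℕ) : (Pi.single k 1 : ℕ → 𝕜) ∈ F.carrier := by
  refine F.mem_of_memℓp_one _ ?_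
  have h := lp.memℓp (lp.single (E := fun _ : ℕ => 𝕜) 1 k 1)
  rwa [lp.coeFn_single] at h

theorem nrm_single_pos (k : ℕ) : 0 < F.nrm (Pi.single k 1) := by
  refine lt_of_le_of_ne (F.nrm_nonneg (F.single_mem k)) fun h => ?_
  have := congrFun (F.eq_zero_of_nrm _ (F.single_mem k) h.symm) k
  simp at this

theorem norm_apply_mul_nrm_single_le {x : ℕ → 𝕜} (hx : x ∈ F.carrier) (k : ℕ) :
    ‖x k‖ * F.nrm (Pi.single k 1) ≤ F.nrm x := by
  rw [← F.nrm_smul _ _ (F.single_mem k)]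
  refine F.nrm_le_of_le _ _ hx fun j => ?_
  rcases eq_or_ne j k with rfl | h
  · simp
  · simp [h]

/-- The `k`-th coordinate, as a continuous functional. -/
noncomputable def coord (k : ℕ) : F.Elem →L[𝕜] 𝕜 :=
  LinearMap.mkContinuous
    { toFun := fun x => x.seq k
      map_add' := fun _ _ => rfl
      map_smul' := fun _ _ => rfl } (F.nrm (Pi.single k 1))⁻¹ (fun x => by
    rw [← div_eq_inv_mul, le_div_iff₀ (F.nrm_single_pos k)]
    exact F.norm_apply_mul_nrm_single_le x.2 k)

theorem abs_mem {x : ℕ → 𝕜} (hx : x ∈ F.carrier) (c : ℝ) :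
    (fun k => ((c * ‖x k‖ : ℝ) : 𝕜)) ∈ F.carrier := by
  refine F.mem_of_le _ _ (F.carrier.smul_mem (c : 𝕜) hx) fun k => ?_
  simp

theorem nrm_abs_le {x : ℕ → 𝕜} (hx : x ∈ F.carrier) (c : ℝ) :
    F.nrm (fun k => ((c * ‖x k‖ : ℝ) : 𝕜)) ≤ |c| * F.nrm x := by
  rw [← RCLike.norm_ofReal (K := 𝕜) c, ← F.nrm_smul _ _ hx]
  refine F.nrm_le_of_le _ _ (F.carrier.smul_mem (c : 𝕜) hx) fun k => ?_
  simp

/-- A sequence of elements of the unit ball is, up to factors `2 ^ m`, dominated by one element. -/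
theorem exists_dominating (x : ℕ → ℕ → 𝕜) (hx : ∀ m, x m ∈ F.carrier)
    (hx1 : ∀ m, F.nrm (x m) ≤ 1) :
    ∃ y ∈ F.carrier, ∀ m k, (1 / 2 : ℝ) ^ m * ‖x m k‖ ≤ ‖y k‖ := by
  let w : ℕ → F.Elem := fun m =>
    (⟨fun k => (((1 / 2 : ℝ) ^ m * ‖x m k‖ : ℝ) : 𝕜), F.abs_mem (hx m) _⟩ : F.carrier)
  have hw : ∀ m, ‖w m‖ ≤ (1 / 2 : ℝ) ^ m := fun m => by
    refine (F.nrm_abs_le (hx m) _).trans ?_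
    rw [abs_of_pos (by positivity)]
    exact mul_le_of_le_one_right (by positivity) (hx1 m)
  -- By completeness of `F`, the dominating element is `∑ 2^(-m) |x m|`; continuity of the
  -- coordinates identifies its entries.
  have hs : Summable w := Summable.of_norm_bounded summable_geometric_two hw
  refine ⟨(∑' m, w m).seq, (∑' m, w m).2, fun m k => ?_⟩
  have h1 := (RCLike.reCLM (K := 𝕜)).hasSum ((F.coord k).hasSum hs.hasSum)
  have h2 : ∀ m, RCLike.reCLM (K := 𝕜) (F.coord k (w m)) = (1 / 2 : ℝ) ^ m * ‖x m k‖ :=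
    fun m => RCLike.ofReal_re (K := 𝕜) ((1 / 2 : ℝ) ^ m * ‖x m k‖)
  simp only [h2] at h1
  refine (le_hasSum h1 m fun j _ => by positivity).trans ?_
  exact RCLike.re_le_norm _

theorem nrm_smul_inv {x : ℕ → 𝕜} (hx : x ∈ F.carrier) (h0 : F.nrm x ≠ 0) :
    F.nrm ((((F.nrm x)⁻¹ : ℝ) : 𝕜) • x) = 1 := by
  rw [F.nrm_smul _ _ hx, RCLike.norm_ofReal, abs_of_nonneg (inv_nonneg.2 (F.nrm_nonneg hx)),
    inv_mul_cancel₀ h0]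

/-- Elements of the Köthe dual act boundedly. -/
theorem exists_tsum_le {z : ℕ → 𝕜} (hz : z ∈ kotheDual (F.carrier : Set (ℕ → 𝕜))) :
    ∃ D : ℝ, 0 < D ∧ ∀ x ∈ F.carrier, ∑' k, ‖z k * x k‖ ≤ D * F.nrm x := by
  by_contra! h
  -- The growth `4^m` beats the loss `2^(-m)` in `exists_dominating`: one `y ∈ F` would satisfy `∑
  -- |z y| ≥ 2^m` for all `m`.
  choose x hx hlt using fun m : ℕ => h ((4 : ℝ) ^ m) (by positivity)
  have h0 : ∀ m, F.nrm (x m) ≠ 0 := fun m h0 => by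
    have := hlt m
    rw [h0, F.eq_zero_of_nrm _ (hx m) h0] at this
    simp at this
  obtain ⟨y, hy, hle⟩ := F.exists_dominating
    (fun m => (((F.nrm (x m))⁻¹ : ℝ) : 𝕜) • x m)
    (fun m => F.carrier.smul_mem _ (hx m)) fun m => (F.nrm_smul_inv (hx m) (h0 m)).le
  obtain ⟨m, hm⟩ := pow_unbounded_of_one_lt (∑' k, ‖z k * y k‖) (one_lt_two (α := ℝ))
  have hpos : 0 < F.nrm (x m) := lt_of_le_of_ne (F.nrm_nonneg (hx m)) (h0 m).symm
  have h1 : ∑' k, (1 / 2 : ℝ) ^ m * (F.nrm (x m))⁻¹ * ‖z k * x m k‖ ≤ ∑' k, ‖z k * y k‖ := by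
    refine Summable.tsum_le_tsum (fun k => ?_) ((hz _ (hx m)).mul_left _) (hz _ hy)
    have := hle m k
    rw [Pi.smul_apply, norm_smul, RCLike.norm_ofReal, abs_of_pos (inv_pos.2 hpos)] at this
    rw [norm_mul, norm_mul]
    calc _ = ‖z k‖ * ((1 / 2 : ℝ) ^ m * ((F.nrm (x m))⁻¹ * ‖x m k‖)) := by ring
      _ ≤ _ := by gcongr
  rw [tsum_mul_left] at h1
  have h2 : (1 / 2 : ℝ) ^ m * (F.nrm (x m))⁻¹ * (4 ^ m * F.nrm (x m)) <
      (1 / 2 : ℝ) ^ m * (F.nrm (x m))⁻¹ * ∑' k, ‖z k * x m k‖ :=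
    mul_lt_mul_of_pos_left (hlt m) (by positivity)
  have h3 : (1 / 2 : ℝ) ^ m * (F.nrm (x m))⁻¹ * (4 ^ m * F.nrm (x m)) = 2 ^ m := by
    rw [show (4 : ℝ) = 2 * 2 by norm_num, mul_pow, one_div, inv_pow]
    field_simp
  linarith

theorem tsum_enorm_eq_ofReal {a : ℕ → 𝕜} (ha : Summable fun k => ‖a k‖) :
    ∑' k, ‖a k‖ₑ = ENNReal.ofReal (∑' k, ‖a k‖) := by
  rw [ENNReal.ofReal_tsum_of_nonneg (fun _ => norm_nonneg _) ha]
  simp only [ofReal_norm]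

theorem tsum_norm_le_of_kotheNorm_le_one {z : ℕ → 𝕜}
    (hz : z ∈ kotheDual (F.carrier : Set (ℕ → 𝕜)))
    (h : kotheNorm (F.carrier : Set (ℕ → 𝕜)) (fun x => ENNReal.ofReal (F.nrm x)) z ≤ 1)
    {x : ℕ → 𝕜} (hx : x ∈ F.carrier) : ∑' k, ‖z k * x k‖ ≤ F.nrm x := by
  rcases eq_or_ne (F.nrm x) 0 with h0 | h0
  · rw [h0, F.eq_zero_of_nrm x hx h0]
    simp
  have hpos : 0 < F.nrm x := lt_of_le_of_ne (F.nrm_nonneg hx) h0.symm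
  set y : ℕ → 𝕜 := (((F.nrm x)⁻¹ : ℝ) : 𝕜) • x with hy
  have hyF : y ∈ F.carrier := F.carrier.smul_mem _ hx
  have h1 : ∑' k, ‖z k * y k‖ₑ ≤ 1 := by
    refine le_trans ?_ h
    refine le_iSup₂_of_le y hyF (le_iSup_of_le ?_ le_rfl)
    exact ENNReal.ofReal_le_one.2 (F.nrm_smul_inv hx h0).le
  rw [tsum_enorm_eq_ofReal (hz y hyF), ENNReal.ofReal_le_one] at h1
  have h2 : ∀ k, ‖z k * y k‖ = (F.nrm x)⁻¹ * ‖z k * x k‖ := fun k => by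
    rw [hy, Pi.smul_apply, smul_eq_mul, mul_left_comm, norm_mul, RCLike.norm_ofReal,
      abs_of_pos (inv_pos.2 hpos)]
  simp only [h2] at h1
  rwa [tsum_mul_left, inv_mul_le_iff₀ hpos, mul_one] at h1

theorem kotheNorm_le_one_of_tsum_le {z : ℕ → 𝕜}
    (hz : z ∈ kotheDual (F.carrier : Set (ℕ → 𝕜)))
    (h : ∀ x ∈ F.carrier, ∑' k, ‖z k * x k‖ ≤ F.nrm x) :
    kotheNorm (F.carrier : Set (ℕ → 𝕜)) (fun x => ENNReal.ofReal (F.nrm x)) z ≤ 1 := by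
  refine iSup₂_le fun x hx => iSup_le fun hx1 => ?_
  rw [tsum_enorm_eq_ofReal (hz x hx), ENNReal.ofReal_le_one]
  exact (h x hx).trans (ENNReal.ofReal_le_one.1 hx1)

theorem smul_mem_kotheDual {S : Set (ℕ → 𝕜)} {z : ℕ → 𝕜} (hz : z ∈ kotheDual S) (c : 𝕜) :
    c • z ∈ kotheDual S := fun x hx => by
  simp only [Pi.smul_apply, smul_eq_mul, mul_assoc, norm_mul c]
  exact (hz x hx).mul_left _

/-- Hölder's inequality between the Köthe dual and the Köthe bidual. -/
theorem tsum_enorm_mul_le {z : ℕ → 𝕜} (hz : z ∈ kotheDual (F.carrier : Set (ℕ → 𝕜))) {D : ℝ}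
    (hD : 0 < D) (h : ∀ x ∈ F.carrier, ∑' k, ‖z k * x k‖ ≤ D * F.nrm x) (v : ℕ → 𝕜) :
    ∑' k, ‖z k * v k‖ₑ ≤ ENNReal.ofReal D * F.kotheBidualNorm v := by
  set w : ℕ → 𝕜 := ((D⁻¹ : ℝ) : 𝕜) • z with hw
  have hwF : w ∈ kotheDual (F.carrier : Set (ℕ → 𝕜)) := smul_mem_kotheDual hz _
  have hw1 : kotheNorm (F.carrier : Set (ℕ → 𝕜)) (fun x => ENNReal.ofReal (F.nrm x)) w ≤ 1 := by
    refine F.kotheNorm_le_one_of_tsum_le hwF fun x hx => ?_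
    have h2 : ∀ k, ‖w k * x k‖ = D⁻¹ * ‖z k * x k‖ := fun k => by
      rw [hw, Pi.smul_apply, smul_eq_mul, mul_assoc, norm_mul, RCLike.norm_ofReal,
        abs_of_pos (inv_pos.2 hD)]
    simp only [h2]
    rw [tsum_mul_left, inv_mul_le_iff₀ hD]
    exact h x hx
  have h3 : ∑' k, ‖v k * w k‖ₑ ≤ F.kotheBidualNorm v :=
    le_iSup₂_of_le w hwF (le_iSup_of_le hw1 le_rfl)
  have h4 : ∀ k, ‖z k * v k‖ₑ = ENNReal.ofReal D * ‖v k * w k‖ₑ := fun k => by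
    have hD' : ENNReal.ofReal D = ‖((D : ℝ) : 𝕜)‖ₑ := by
      rw [← ofReal_norm, RCLike.norm_ofReal, abs_of_pos hD]
    rw [hD', ← enorm_mul, hw, Pi.smul_apply, smul_eq_mul]
    congr 1
    have : ((D : ℝ) : 𝕜) ≠ 0 := RCLike.ofReal_ne_zero.2 hD.ne'
    push_cast
    field_simp
  simp only [h4]
  rw [ENNReal.tsum_mul_left]
  gcongr

theorem kotheBidualNorm_le {x : ℕ → 𝕜} (hx : x ∈ F.carrier) :
    F.kotheBidualNorm x ≤ ENNReal.ofReal (F.nrm x) := by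
  refine iSup₂_le fun z hz => iSup_le fun hz1 => ?_
  simp only [mul_comm (x _)]
  rw [tsum_enorm_eq_ofReal (hz x hx)]
  exact ENNReal.ofReal_le_ofReal (F.tsum_norm_le_of_kotheNorm_le_one hz hz1 hx)

theorem kotheBidualNorm_smul_le (c : 𝕜) (x : ℕ → 𝕜) :
    F.kotheBidualNorm (c • x) ≤ ‖c‖ₑ * F.kotheBidualNorm x := by
  refine iSup₂_le fun z hz => iSup_le fun hz1 => ?_
  simp only [Pi.smul_apply, smul_eq_mul, mul_assoc, enorm_mul c]
  rw [ENNReal.tsum_mul_left]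
  gcongr
  exact le_iSup₂_of_le z hz (le_iSup_of_le hz1 le_rfl)

theorem single_mem_kotheDual (k : ℕ) :
    (Pi.single k 1 : ℕ → 𝕜) ∈ kotheDual (F.carrier : Set (ℕ → 𝕜)) := fun x _ => by
  refine summable_of_ne_finset_zero (s := {k}) fun j hj => ?_
  rw [Finset.mem_singleton] at hj
  simp [hj]

/-- On a Köthe reflexive space, the norm is equivalent to the norm of the Köthe bidual. -/
theorem IsKotheReflexive.exists_nrm_le {F : BanachSequenceSpace 𝕜} (hF : F.IsKotheReflexive) :
    ∃ c : ℝ, 0 ≤ c ∧ ∀ x ∈ F.carrier, F.nrm x ≤ c * (F.kotheBidualNorm x).toReal := by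
  by_contra! h
  choose x hx hlt using fun m : ℕ => h ((4 : ℝ) ^ m) (by positivity)
  have hpos : ∀ m, 0 < F.nrm (x m) := fun m => lt_of_le_of_lt (by positivity) (hlt m)
  -- Scaled so that `v m` has norm `2^m` in `F` but at most `2^(-m)` in `F^{××}`. Then `y = ∑ |v m|`
  -- lies in `F^{××}`, hence in `F`, and dominates every `v m`, which is absurd.
  set c : ℕ → ℝ := fun m => 2 ^ m / F.nrm (x m) with hc
  have hc0 : ∀ m, 0 < c m := fun m => div_pos (by positivity) (hpos m)
  set v : ℕ → ℕ → 𝕜 := fun m => ((c m : ℝ) : 𝕜) • x m with hv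
  have hvF : ∀ m, v m ∈ F.carrier := fun m => F.carrier.smul_mem _ (hx m)
  have hvn : ∀ m, F.nrm (v m) = 2 ^ m := fun m => by
    rw [hv, F.nrm_smul _ _ (hx m), RCLike.norm_ofReal, abs_of_pos (hc0 m),
      div_mul_cancel₀ _ (hpos m).ne']
  have hvb : ∀ m, F.kotheBidualNorm (v m) ≤ ENNReal.ofReal ((1 / 2) ^ m) := fun m => by
    refine (F.kotheBidualNorm_smul_le _ _).trans ?_
    have hfin : F.kotheBidualNorm (x m) ≠ ∞ :=
      ne_top_of_le_ne_top ENNReal.ofReal_ne_top (F.kotheBidualNorm_le (hx m))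
    rw [← ENNReal.ofReal_toReal hfin, ← ofReal_norm, RCLike.norm_ofReal, abs_of_pos (hc0 m),
      ← ENNReal.ofReal_mul (hc0 m).le]
    refine ENNReal.ofReal_le_ofReal ?_
    rw [hc, div_mul_eq_mul_div, div_le_iff₀ (hpos m), one_div, inv_pow, ← div_eq_inv_mul,
      le_div_iff₀ (by positivity)]
    refine le_of_eq_of_le ?_ (hlt m).le
    rw [show (4 : ℝ) = 2 * 2 by norm_num, mul_pow]
    ring
  have hfin : ∀ z ∈ kotheDual (F.carrier : Set (ℕ → 𝕜)),
      ∑' m, ∑' k, ‖z k * v m k‖ₑ ≠ ∞ := fun z hz => by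
    obtain ⟨D, hD, hzD⟩ := F.exists_tsum_le hz
    refine ne_top_of_le_ne_top ?_ (ENNReal.tsum_le_tsum fun m =>
      (F.tsum_enorm_mul_le hz hD hzD (v m)).trans (mul_le_mul_right (hvb m) _))
    rw [ENNReal.tsum_mul_left]
    refine ENNReal.mul_ne_top ENNReal.ofReal_ne_top ?_
    rw [← ENNReal.ofReal_tsum_of_nonneg (fun m => by positivity) summable_geometric_two]
    exact ENNReal.ofReal_ne_top
  have hsum : ∀ k, Summable fun m => ‖v m k‖ := fun k => by
    refine tsum_enorm_ne_top_iff_summable_norm.1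
      (ne_top_of_le_ne_top (hfin _ (F.single_mem_kotheDual k)) (ENNReal.tsum_le_tsum fun m => ?_))
    refine le_of_eq_of_le ?_ (ENNReal.le_tsum k)
    simp
  set y : ℕ → 𝕜 := fun k => ((∑' m, ‖v m k‖ : ℝ) : 𝕜) with hy
  have hyn : ∀ k, ‖y k‖ = ∑' m, ‖v m k‖ := fun k => by
    rw [hy, RCLike.norm_ofReal, abs_of_nonneg (tsum_nonneg fun _ => norm_nonneg _)]
  have hyF : y ∈ F.carrier := hF y fun z hz => by
    refine tsum_enorm_ne_top_iff_summable_norm.1 (ne_top_of_le_ne_top (hfin z hz) ?_)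
    rw [ENNReal.tsum_comm]
    refine ENNReal.tsum_le_tsum fun k => ?_
    simp only [enorm_mul]
    rw [ENNReal.tsum_mul_left, tsum_enorm_eq_ofReal (hsum k), ← hyn, ofReal_norm, mul_comm]
  obtain ⟨m, hm⟩ := pow_unbounded_of_one_lt (F.nrm y) (one_lt_two (α := ℝ))
  have := F.nrm_le_of_le (v m) y hyF fun k => by
    rw [hyn]
    exact (hsum k).le_tsum m fun _ _ => norm_nonneg _
  rw [hvn] at this
  linarith

/-- Finite sections suffice because all terms are nonnegative. Membership needs each `z` with its
own bound `D`; the norm estimate needs only `D = 1`. -/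
theorem kotheBidualNorm_le_of_sum_le {α : ℕ → 𝕜} {B : ℝ}
    (h : ∀ z ∈ kotheDual (F.carrier : Set (ℕ → 𝕜)), ∀ D : ℝ, 0 < D →
      (∀ x ∈ F.carrier, ∑' k, ‖z k * x k‖ ≤ D * F.nrm x) →
        ∀ N : ℕ, ∑ k : Fin N, ‖z k * α k‖ ≤ D * B) :
    α ∈ F.kotheBidual ∧ F.kotheBidualNorm α ≤ ENNReal.ofReal B := by
  refine ⟨fun z hz => ?_, iSup₂_le fun z hz => iSup_le fun hz1 => ?_⟩
  · obtain ⟨D, hD, hzD⟩ := F.exists_tsum_le hz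
    refine summable_of_sum_range_le (c := D * B) (fun _ => norm_nonneg _) fun N => ?_
    rw [Finset.sum_range]
    simp only [mul_comm (α _)]
    exact h z hz D hD hzD N
  · refine ENNReal.tsum_le_of_sum_range_le fun N => ?_
    have h1 := h z hz 1 one_pos (fun x hx => by
      rw [one_mul]
      exact F.tsum_norm_le_of_kotheNorm_le_one hz hz1 hx) N
    rw [one_mul] at h1
    refine le_of_eq_of_le ?_ (ENNReal.ofReal_le_ofReal h1)
    rw [ENNReal.ofReal_sum_of_nonneg fun _ _ => norm_nonneg _, Finset.sum_range]
    simp only [mul_comm (α _), ofReal_norm]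

end BanachSequenceSpace

end SequenceSpaces

/-! ### Extensions of diagonal operators and the extendible norm -/

section DiagonalOperators

variable {𝕜 : Type u} [RCLike 𝕜]

/-- The form `x ↦ a * ∏ φ (x i)`. -/
noncomputable def prodForm {X : Type*} [AddCommGroup X] [Module 𝕜 X] (n : ℕ) (a : 𝕜)
    (φ : X →ₗ[𝕜] 𝕜) : MultilinearMap 𝕜 (fun _ : Fin n => X) 𝕜 :=
  a • (MultilinearMap.mkPiAlgebra 𝕜 (Fin n) 𝕜).compLinearMap fun _ => φ

theorem prodForm_apply {X : Type*} [AddCommGroup X] [Module 𝕜 X] {n : ℕ} (a : 𝕜)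
    (φ : X →ₗ[𝕜] 𝕜) (x : Fin n → X) : prodForm n a φ x = a * ∏ i, φ (x i) := by
  simp [prodForm]

namespace BanachSequenceSpace

variable (F : BanachSequenceSpace 𝕜) {X : Type*} [NormedAddCommGroup X] [NormedSpace 𝕜 X] {n : ℕ}

theorem norm_prodForm_le {φ : StrongDual 𝕜 X} (hφ : ‖φ‖ ≤ 1) (a : 𝕜) (x : Fin n → X) :
    ‖prodForm n a φ.toLinearMap x‖ ≤ ‖((∏ i, ‖x i‖ : ℝ) : 𝕜) * a‖ := by
  rw [prodForm_apply, norm_mul, norm_mul, mul_comm, RCLike.norm_ofReal,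
    abs_of_nonneg (Finset.prod_nonneg fun _ _ => norm_nonneg _), norm_prod]
  gcongr with i
  exact (φ.le_of_opNorm_le hφ (x i)).trans_eq (one_mul _)

/-- Functionals `φ k` of norm at most one and `α ∈ F` define an `n`-linear map into `F`. -/
theorem exists_multilinear {α : ℕ → 𝕜} (hα : α ∈ F.carrier) (φ : ℕ → StrongDual 𝕜 X)
    (hφ : ∀ k, ‖φ k‖ ≤ 1) :
    ∃ S : ContinuousMultilinearMap 𝕜 (fun _ : Fin n => X) F.Elem,
      (∀ x k, (S x).seq k = α k * ∏ i, φ k (x i)) ∧ ‖S‖ ≤ F.nrm α := by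
  -- Coordinatewise domination by a multiple of `α`: solidity then gives both membership in `F` and
  -- the norm estimate.
  have hle : ∀ (x : Fin n → X) (k : ℕ), ‖prodForm n (α k) (φ k).toLinearMap x‖ ≤
      ‖(((∏ i, ‖x i‖ : ℝ) : 𝕜) • α) k‖ := fun x k => norm_prodForm_le (hφ k) (α k) x
  have hmem : ∀ x : Fin n → X, (((∏ i, ‖x i‖ : ℝ) : 𝕜) • α) ∈ F.carrier := fun x =>
    F.carrier.smul_mem _ hα
  let S₀ : MultilinearMap 𝕜 (fun _ : Fin n => X) F.Elem :=
    { toFun := fun x => (⟨fun k => prodForm n (α k) (φ k).toLinearMap x,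
        F.mem_of_le _ _ (hmem x) (hle x)⟩ : F.carrier)
      map_update_add' := fun x i y z => Subtype.ext (funext fun k =>
        (prodForm n (α k) (φ k).toLinearMap).map_update_add x i y z)
      map_update_smul' := fun x i c y => Subtype.ext (funext fun k =>
        (prodForm n (α k) (φ k).toLinearMap).map_update_smul x i c y) }
  have hS₀ : ∀ x, ‖S₀ x‖ ≤ F.nrm α * ∏ i, ‖x i‖ := fun x => by
    refine (F.nrm_le_of_le _ _ (hmem x) (hle x)).trans_eq ?_
    rw [F.nrm_smul _ _ hα, RCLike.norm_ofReal,
      abs_of_nonneg (Finset.prod_nonneg fun _ _ => norm_nonneg _), mul_comm]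
  exact ⟨S₀.mkContinuous _ hS₀, fun x k => prodForm_apply _ _ _,
    S₀.mkContinuous_norm_le (F.nrm_nonneg hα) hS₀⟩

end BanachSequenceSpace

theorem lp.norm_evalCLM_le (p : ℝ≥0∞) [Fact (1 ≤ p)] (k : ℕ) :
    ‖lp.evalCLM 𝕜 (fun _ : ℕ => 𝕜) p k‖ ≤ 1 :=
  LinearMap.mkContinuous_norm_le _ zero_le_one _

/-- Hahn-Banach: functionals extend along linear isometries. -/
theorem LinearIsometry.exists_dual_extension {E X : Type*} [NormedAddCommGroup E]
    [NormedSpace 𝕜 E] [NormedAddCommGroup X] [NormedSpace 𝕜 X] (ι : E →ₗᵢ[𝕜] X)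
    (f : StrongDual 𝕜 E) (hf : ‖f‖ ≤ 1) :
    ∃ g : StrongDual 𝕜 X, ‖g‖ ≤ 1 ∧ ∀ x, g (ι x) = f x := by
  let e := ι.equivRange
  obtain ⟨g, hg, hgn⟩ := exists_extension_norm_eq (LinearMap.range ι.toLinearMap)
    (f.comp (e.symm.toContinuousLinearEquiv : _ →L[𝕜] E))
  refine ⟨g, ?_, fun x => ?_⟩
  · rw [hgn]
    refine ContinuousLinearMap.opNorm_le_bound _ zero_le_one fun y => ?_
    refine (f.le_of_opNorm_le hf _).trans_eq ?_
    congr 1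
    exact e.symm.norm_map y
  · have h := hg (e x)
    refine h.trans ?_
    change f (e.symm (e x)) = f x
    rw [e.symm_apply_apply]

variable {n : ℕ} {p : ℝ≥0∞} [Fact (1 ≤ p)] {F : BanachSequenceSpace 𝕜} {α : ℕ → 𝕜}

theorem IsDiagonalOperator.exists_extension
    {T : ContinuousMultilinearMap 𝕜 (fun _ : Fin n => lp (fun _ : ℕ => 𝕜) p) F.Elem}
    (hT : IsDiagonalOperator α T) (hα : α ∈ F.carrier) {X : Type*} [NormedAddCommGroup X]
    [NormedSpace 𝕜 X] (ι : lp (fun _ : ℕ => 𝕜) p →ₗᵢ[𝕜] X) :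
    ∃ S : ContinuousMultilinearMap 𝕜 (fun _ : Fin n => X) F.Elem,
      (∀ x, S (fun i => ι (x i)) = T x) ∧ ‖S‖ ≤ F.nrm α := by
  choose g hg hgι using fun k => ι.exists_dual_extension _ (lp.norm_evalCLM_le (𝕜 := 𝕜) p k)
  obtain ⟨S, hS, hSn⟩ := F.exists_multilinear (n := n) hα g hg
  refine ⟨S, fun x => Subtype.ext (funext fun k => ?_), hSn⟩
  refine (hS _ k).trans (Eq.trans ?_ (hT x k).symm)
  simp only [hgι]
  rfl

theorem mem_extendibleDiagonals (hα : α ∈ F.carrier) : α ∈ extendibleDiagonals n p F := by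
  obtain ⟨T, hT, -⟩ := F.exists_multilinear (n := n) hα
    (fun k => lp.evalCLM 𝕜 (fun _ : ℕ => 𝕜) p k) fun k => lp.norm_evalCLM_le p k
  have hT : IsDiagonalOperator α T := fun x k => hT x k
  refine ⟨T, hT, fun X _ _ _ ι => ?_⟩
  obtain ⟨S, hS, -⟩ := hT.exists_extension hα ι
  exact ⟨S, hS⟩

theorem extendibleNorm_nonneg {E G : Type*} [NormedAddCommGroup E] [NormedSpace 𝕜 E]
    [NormedAddCommGroup G] [NormedSpace 𝕜 G]
    (T : ContinuousMultilinearMap 𝕜 (fun _ : Fin n => E) G) : 0 ≤ extendibleNorm T :=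
  Real.sInf_nonneg fun _ h => h.1.le

theorem IsDiagonalOperator.extendibleNorm_le
    {T : ContinuousMultilinearMap 𝕜 (fun _ : Fin n => lp (fun _ : ℕ => 𝕜) p) F.Elem}
    (hT : IsDiagonalOperator α T) (hα : α ∈ F.carrier) : extendibleNorm T ≤ F.nrm α := by
  -- The slack `ε` is needed because the infimum is over `C > 0`, while `F.nrm α` may vanish.
  refine le_of_forall_pos_le_add fun ε hε => csInf_le ⟨0, fun _ h => h.1.le⟩
    ⟨add_pos_of_nonneg_of_pos (F.nrm_nonneg hα) hε, fun X _ _ _ ι => ?_⟩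
  obtain ⟨S, hS, hSn⟩ := hT.exists_extension hα ι
  exact ⟨S, hS, by linarith⟩

/-- Membership of `α` in `F` provides a bound uniform in `X`, so that the infimum is over a nonempty
set; `IsExtendible` alone does not state such uniformity. -/
theorem exists_extension_norm_le_of_extendibleNorm_lt
    {T : ContinuousMultilinearMap 𝕜 (fun _ : Fin n => lp (fun _ : ℕ => 𝕜) p) F.Elem}
    (hT : IsDiagonalOperator α T) (hα : α ∈ F.carrier) {C : ℝ} (hC : extendibleNorm T < C)
    (X : Type u) [NormedAddCommGroup X] [NormedSpace 𝕜 X] [CompleteSpace X]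
    (ι : lp (fun _ : ℕ => 𝕜) p →ₗᵢ[𝕜] X) :
    ∃ S : ContinuousMultilinearMap 𝕜 (fun _ : Fin n => X) F.Elem,
      (∀ x, S (fun i => ι (x i)) = T x) ∧ ‖S‖ ≤ C := by
  obtain ⟨C', hC', hlt⟩ := exists_lt_of_csInf_lt (by
    refine ⟨F.nrm α + 1, add_pos_of_nonneg_of_pos (F.nrm_nonneg hα) one_pos, fun X _ _ _ ι => ?_⟩
    obtain ⟨S, hS, hSn⟩ := hT.exists_extension hα ι
    exact ⟨S, hS, by linarith⟩) hC
  obtain ⟨S, hS, hSn⟩ := hC'.2 X ι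
  exact ⟨S, hS, hSn.trans hlt.le⟩

/-- Extensions of `T_α` control `α` in the Köthe bidual. -/
theorem IsDiagonalOperator.kotheBidualNorm_le_of_extension (hn : 2 ≤ n) (hp : 2 ≤ p)
    {T : ContinuousMultilinearMap 𝕜 (fun _ : Fin n => lp (fun _ : ℕ => 𝕜) p) F.Elem}
    (hT : IsDiagonalOperator α T)
    (S : ContinuousMultilinearMap 𝕜 (fun _ : Fin n =>
      lp (fun _ : {φ : StrongDual 𝕜 (lp (fun _ : ℕ => 𝕜) p) // ‖φ‖ ≤ 1} => 𝕜) ∞) F.Elem)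
    (hS : ∀ x, S (fun i => dualBallEmbedding 𝕜 _ (x i)) = T x) :
    α ∈ F.kotheBidual ∧
      F.kotheBidualNorm α ≤ ENNReal.ofReal (grothendieckConstant 𝕜 ^ (n - 1) * ‖S‖) := by
  obtain ⟨m, rfl⟩ := Nat.exists_eq_add_of_le' hn
  refine F.kotheBidualNorm_le_of_sum_le fun z hz D hD hzD N => ?_
  have h := sum_norm_mul_le_of_extension hT (dualBallEmbedding 𝕜 _)
    (fun N φ => sum_norm_apply_single_sq_le_one hp φ.1 φ.2 N) S hS z hD.le N fun x hx => by
      refine le_trans ?_ (hzD x hx)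
      rw [← Finset.sum_range fun k => ‖z k * x k‖]
      exact (hz x hx).sum_le_tsum _ fun _ _ => norm_nonneg _
  refine h.trans_eq ?_
  rw [mul_left_comm]
  rfl

/-- Any single extension suffices, without control of its norm. Reflexivity then gives `α ∈ F`, on
which the quantitative bound relies. -/
theorem IsDiagonalOperator.mem_kotheBidual (hn : 2 ≤ n) (hp : 2 ≤ p)
    {T : ContinuousMultilinearMap 𝕜 (fun _ : Fin n => lp (fun _ : ℕ => 𝕜) p) F.Elem}
    (hT : IsDiagonalOperator α T) (hE : IsExtendible T) : α ∈ F.kotheBidual := by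
  obtain ⟨S, hS⟩ := hE _ (dualBallEmbedding 𝕜 (lp (fun _ : ℕ => 𝕜) p))
  exact (hT.kotheBidualNorm_le_of_extension hn hp S hS).1

theorem IsDiagonalOperator.kotheBidualNorm_le (hn : 2 ≤ n) (hp : 2 ≤ p)
    {T : ContinuousMultilinearMap 𝕜 (fun _ : Fin n => lp (fun _ : ℕ => 𝕜) p) F.Elem}
    (hT : IsDiagonalOperator α T) (hα : α ∈ F.carrier) :
    F.kotheBidualNorm α ≤
      ENNReal.ofReal (grothendieckConstant 𝕜 ^ (n - 1) * extendibleNorm T) := by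
  have hlim : Filter.Tendsto
      (fun C : ℝ => ENNReal.ofReal (grothendieckConstant 𝕜 ^ (n - 1) * C))
      (nhdsWithin (extendibleNorm T) (Set.Ioi (extendibleNorm T)))
      (nhds (ENNReal.ofReal (grothendieckConstant 𝕜 ^ (n - 1) * extendibleNorm T))) := by
    refine (ENNReal.continuous_ofReal.comp (continuous_const.mul continuous_id)).continuousAt
      |>.tendsto.mono_left nhdsWithin_le_nhds
  refine ge_of_tendsto hlim ?_
  filter_upwards [self_mem_nhdsWithin] with C hC
  obtain ⟨S, hS, hSn⟩ := exists_extension_norm_le_of_extendibleNorm_lt hT hα hC _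
    (dualBallEmbedding 𝕜 (lp (fun _ : ℕ => 𝕜) p))
  refine (hT.kotheBidualNorm_le_of_extension hn hp S hS).2.trans (ENNReal.ofReal_le_ofReal ?_)
  exact mul_le_mul_of_nonneg_left hSn (pow_nonneg grothendieckConstant_nonneg _)

end DiagonalOperators
theorem proposition3p7 {𝕜 : Type u} [RCLike 𝕜] {n : ℕ} (hn : 2 ≤ n) {p : ℝ≥0∞} [Fact (1 ≤ p)]
    (hp : 2 ≤ p) (F : BanachSequenceSpace 𝕜) (hF : F.IsKotheReflexive) :
    -- `T_α` is extendible if and only if `α ∈ F`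
    (∀ α : ℕ → 𝕜, α ∈ extendibleDiagonals n p F ↔ α ∈ F.carrier) ∧
    -- `‖T_α‖_𝓔 ≤ ‖α‖_F` and `‖α‖_{F^{××}} ≤ K_G ^ (n - 1) * ‖T_α‖_𝓔`
    (∀ (α : ℕ → 𝕜)
      (T : ContinuousMultilinearMap 𝕜 (fun _ : Fin n => lp (fun _ : ℕ => 𝕜) p) F.Elem),
      IsDiagonalOperator α T → IsExtendible T →
        extendibleNorm T ≤ F.nrm α ∧
        F.kotheBidualNorm α ≤
          ENNReal.ofReal (grothendieckConstant 𝕜 ^ (n - 1) * extendibleNorm T)) ∧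
    -- the norms `‖α‖_F` and `‖T_α‖_𝓔` are equivalent
    (∃ c : ℝ, ∀ (α : ℕ → 𝕜)
      (T : ContinuousMultilinearMap 𝕜 (fun _ : Fin n => lp (fun _ : ℕ => 𝕜) p) F.Elem),
      IsDiagonalOperator α T → IsExtendible T → F.nrm α ≤ c * extendibleNorm T) ∧
    -- with constant `K_G ^ (n - 1)` as soon as `F` and `F^{××}` have the same norm
    ((∀ x ∈ F.carrier, F.kotheBidualNorm x = ENNReal.ofReal (F.nrm x)) →
      ∀ (α : ℕ → 𝕜)
        (T : ContinuousMultilinearMap 𝕜 (fun _ : Fin n => lp (fun _ : ℕ => 𝕜) p) F.Elem),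
        IsDiagonalOperator α T → IsExtendible T →
          F.nrm α ≤ grothendieckConstant 𝕜 ^ (n - 1) * extendibleNorm T) := by
  have hmem : ∀ (α : ℕ → 𝕜)
      (T : ContinuousMultilinearMap 𝕜 (fun _ : Fin n => lp (fun _ : ℕ => 𝕜) p) F.Elem),
      IsDiagonalOperator α T → IsExtendible T → α ∈ F.carrier := fun α T hT hE =>
    hF α (hT.mem_kotheBidual hn hp hE)
  have hK : ∀ T : ContinuousMultilinearMap 𝕜 (fun _ : Fin n => lp (fun _ : ℕ => 𝕜) p) F.Elem,
      0 ≤ grothendieckConstant 𝕜 ^ (n - 1) * extendibleNorm T := fun T =>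
    mul_nonneg (pow_nonneg grothendieckConstant_nonneg _) (extendibleNorm_nonneg T)
  refine ⟨fun α => ⟨fun ⟨T, hT, hE⟩ => hmem α T hT hE, mem_extendibleDiagonals⟩,
    fun α T hT hE => ⟨hT.extendibleNorm_le (hmem α T hT hE),
      hT.kotheBidualNorm_le hn hp (hmem α T hT hE)⟩, ?_, fun hnorm α T hT hE => ?_⟩
  · obtain ⟨c, hc, h⟩ := hF.exists_nrm_le
    refine ⟨c * grothendieckConstant 𝕜 ^ (n - 1), fun α T hT hE => ?_⟩
    have hα := hmem α T hT hE
    rw [mul_assoc]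
    exact (h α hα).trans (mul_le_mul_of_nonneg_left
      (ENNReal.toReal_le_of_le_ofReal (hK T) (hT.kotheBidualNorm_le hn hp hα)) hc)
  · have hα := hmem α T hT hE
    have h := hT.kotheBidualNorm_le hn hp hα
    rw [hnorm α hα] at h
    exact (ENNReal.ofReal_le_ofReal_iff (hK T)).1 h
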